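/- Let $\mathbb F$ be a field of characteristic $0$. An associative interchange algebra over $\mathbb F$ is a vector space with two associative bilinear operations $\circ,\bullet$ satisfying $(a\circ b)\bullet(c\circ d)\equiv(a\bullet c)\circ(b\bullet d)$. In the free associative interchange algebra on countably many generators consider the two Jordan products $\{a,b\}_\circ=a\circ b+b\circ a$ and $\{a,b\}_\bullet=a\bullet b+b\bullet a$. For $n\ge 1$ let $\mathrm{All}(n)$ be the $S_n$-module of multilinear polynomials in $n$ variables $x_1,\dots,x_n$ and two binary operation symbols, in which $S_n$ permutes the variables, that are identities of the two Jordan products. Let $\mathrm{Old}(n)$ be the submodule of those multilinear polynomials that are consequences of the identities in $\mathrm{All}(k)$, $k<n$; here the consequences of a set of identities are the elements of the ideal of the free algebra (with two bilinear operations and no relations) generated by all results of substituting polynomials for the variables in the given identities. (1) A multilinear polynomial of degree $5$ is an identity of the two Jordan products if and only if it is a consequence of the following identities: (i) commutativity $\{a,b\}_*\equiv\{b,a\}_*$ and the linearization of the Jordan identity $\{a,\{b,\{a,a\}_*\}_*\}_*\equiv\{\{a,b\}_*,\{a,a\}_*\}_*$, for each $*\in\{\circ,\bullet\}$; (ii)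 the linearization of $\{\{a,a\}_\circ,\{a,a\}_\circ\}_\bullet-\{\{a,a\}_\bullet,\{a,a\}_\bullet\}_\circ\equiv 0$; (iii) the linearizations of $$\{\{a,b\}_\circ,\{a,\{a,a\}_\circ\}_\circ\}_\bullet-\{\{a,a\}_\bullet,\{b,\{a,a\}_\circ\}_\bullet\}_\circ\equiv 0,$$ $$\{\{a,a\}_\circ,\{b,\{a,a\}_\bullet\}_\circ\}_\bullet-\{\{a,b\}_\bullet,\{a,\{a,a\}_\bullet\}_\bullet\}_\circ\equiv 0.$$ (2) $\mathrm{Old}(5)$ consists of the multilinear polynomials of degree $5$ that are consequences of the identities (i) and (ii). (3) The two linearized identities in (iii) belong to $\mathrm{All}(5)$. In $\mathrm{New}(5)=\mathrm{All}(5)/\mathrm{Old}(5)$ the class of each of them generates a simple $S_5$-submodule isomorphic to $[41]$, the simple $S_5$-module of the partition $4+1$, and $\mathrm{New}(5)$ is the direct sum of these two submodules. Thus there are exactly two new irreducible identities in degree $5$, both for the partition $41$. -/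

import Mathlib

noncomputable section

namespace JJ

/-! ### Free algebras with two bilinear operations -/

/-- The two operation symbols. -/
inductive Op
  | circ
  | bullet

/-- Nonassociative monomials in the variables `X` built with the two operation symbols. -/
inductive Mon (X : Type*)
  | var (x : X) : Mon X
  | mul (o : Op) (l r : Mon X) : Mon X

namespace Mon

variable {X Y A : Type*}

/-- Value of a monomial under given operations and values of the variables. -/
def eval (op : Op → A → A → A) (a : X → A) : Mon X → A
  | var x => a x
  | mul o l r => op o (eval op a l) (eval op a r)

/-- Renaming of variables. -/
def map (g : X → Y) : Mon X → Mon Y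
  | var x => var (g x)
  | mul o l r => mul o (map g l) (map g r)

open Classical in
/-- The number of occurrences of the variable `x`. -/
def count (x : X) : Mon X → ℕ
  | var y => if y = x then 1 else 0
  | mul _ l r => count x l + count x r

/-- Every variable of `X` occurs exactly once. -/
def IsMultilinear (m : Mon X) : Prop := ∀ x, m.count x = 1

theorem map_id (m : Mon X) : m.map id = m := by
  induction m with
  | var x => rfl
  | mul o l r hl hr => simp [map, hl, hr]

theorem map_map {Z : Type*} (h : Y → Z) (g : X → Y) (m : Mon X) :
    (m.map g).map h = m.map (h ∘ g) := by
  induction m with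
  | var x => rfl
  | mul o l r hl hr => simp [map, hl, hr]

theorem eval_map (op : Op → A → A → A) (a : Y → A) (g : X → Y) (m : Mon X) :
    (m.map g).eval op a = m.eval op (a ∘ g) := by
  induction m with
  | var x => rfl
  | mul o l r hl hr => simp [map, eval, hl, hr]

theorem count_map (s : Equiv.Perm X) (x : X) (m : Mon X) :
    (m.map s).count x = m.count (s.symm x) := by
  classical
  induction m with
  | var y =>
    simp only [map, count]
    exact if_congr (Equiv.eq_symm_apply s).symm rfl rfl
  | mul o l r hl hr => simp [map, count, hl, hr]

end Mon

/-- The free algebra over `F` on `X` with two bilinear operations: the vector space whose basis is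
the set of monomials. -/
abbrev Poly (F : Type*) [Field F] (X : Type*) : Type _ := Mon X →₀ F

/-- A pair of bilinear operations on the vector space `A`. -/
abbrev BilinOps (F : Type*) [Field F] (A : Type*) [AddCommGroup A] [Module F A] : Type _ :=
  Op → A →ₗ[F] A →ₗ[F] A

section Field

variable {F : Type*} [Field F]

namespace Poly

variable {X Y A B : Type*} [AddCommGroup A] [Module F A] [AddCommGroup B] [Module F B]

/-- A variable, as an element of the free algebra. -/
def var (x : X) : Poly F X := Finsupp.single (Mon.var x) 1

variable (F X) in
/-- The two operations of the free algebra: the bilinear extensions of the operations on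
monomials. -/
def mul : BilinOps F (Poly F X) := fun o =>
  Finsupp.linearCombination F fun m =>
    Finsupp.linearCombination F fun m' => (Finsupp.single (Mon.mul o m m') (1 : F) : Poly F X)

/-- Evaluation of a polynomial in an algebra with two bilinear operations. -/
def eval (op : BilinOps F A) (a : X → A) : Poly F X →ₗ[F] A :=
  Finsupp.linearCombination F fun m => m.eval (fun o x y => op o x y) a

/-- Substitution of polynomials for the variables. -/
def subst (φ : X → Poly F Y) : Poly F X →ₗ[F] Poly F Y := eval (mul F Y) φ

/-- The linear map that renames the variables. -/
def rename (g : X → Y) : Poly F X →ₗ[F] Poly F Y := Finsupp.lmapDomain F F (Mon.map g)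

theorem rename_mul (g : X → Y) (o : Op) (p q : Poly F X) :
    rename g (mul F X o p q) = mul F Y o (rename g p) (rename g q) := by
  have h : (mul F X o).compr₂ (rename g) = (mul F Y o).compl₁₂ (rename g) (rename g) := by
    ext m m'
    simp [mul, rename, Mon.map]
  simpa using LinearMap.congr_fun₂ h p q

theorem rename_subst {Z : Type*} (g : Y → Z) (φ : X → Poly F Y) (f : Poly F X) :
    rename g (subst φ f) = subst (fun x => rename g (φ x)) f := by
  have h : (rename g).comp (subst φ) = subst (fun x => rename g (φ x)) := by
    refine Finsupp.lhom_ext' fun m => LinearMap.ext_ring ?_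
    simp only [subst, eval, LinearMap.comp_apply, Finsupp.lsingle_apply,
      Finsupp.linearCombination_single, one_smul]
    induction m with
    | var x => rfl
    | mul o l r hl hr => simp only [Mon.eval, rename_mul, hl, hr]
  exact LinearMap.congr_fun h f

theorem eval_rename (op : BilinOps F A) (a : Y → A) (g : X → Y) (f : Poly F X) :
    eval op a (rename g f) = eval op (a ∘ g) f := by
  have h : (eval op a).comp (rename g) = eval op (a ∘ g) := by
    ext m
    simp [eval, rename, Mon.eval_map]
  exact LinearMap.congr_fun h f

end Poly

/-- `f` is a polynomial identity of the algebra `A` with the operations `op`. -/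
def IsIdentity {X A : Type*} [AddCommGroup A] [Module F A] (op : BilinOps F A) (f : Poly F X) :
    Prop :=
  ∀ a : X → A, f.eval op a = 0

/-- The two Jordan products `{x, y} = x * y + y * x`. -/
def jordan {A : Type*} [AddCommGroup A] [Module F A] (op : BilinOps F A) : BilinOps F A :=
  fun o => op o + (op o).flip

/-! ### Ideals and consequences of identities -/

/-- `I` is a two-sided ideal for both operations. -/
def IsIdeal {A : Type*} [AddCommGroup A] [Module F A] (op : BilinOps F A) (I : Submodule F A) :
    Prop :=
  ∀ o x, ∀ y ∈ I, op o x y ∈ I ∧ op o y x ∈ I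

/-- The ideal generated by a set. -/
def idealSpan {A : Type*} [AddCommGroup A] [Module F A] (op : BilinOps F A) (S : Set A) :
    Submodule F A :=
  sInf {I | IsIdeal op I ∧ S ⊆ I}

/-- The consequences in the variables `X` of a collection `S` of identities (`S n` holds the
members of the collection that are written in `n` variables): the ideal of the free algebra on `X`
generated by everything obtained by substituting polynomials for the variables of a member
of `S`. -/
def consequences (S : ∀ n : ℕ, Set (Poly F (Fin n))) (X : Type*) : Submodule F (Poly F X) :=
  idealSpan (Poly.mul F X)
    {g | ∃ n, ∃ f ∈ S n, ∃ φ : Fin n → Poly F X, g = Poly.subst φ f}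

theorem isIdeal_idealSpan {A : Type*} [AddCommGroup A] [Module F A] (op : BilinOps F A)
    (S : Set A) : IsIdeal op (idealSpan op S) := by
  intro o x y hy
  simp only [idealSpan, Submodule.mem_sInf] at hy ⊢
  exact ⟨fun I hI => (hI.1 o x y (hy I hI)).1, fun I hI => (hI.1 o x y (hy I hI)).2⟩

theorem rename_mem_consequences (S : ∀ n : ℕ, Set (Poly F (Fin n))) {X Y : Type*} (g : X → Y)
    {f : Poly F X} (hf : f ∈ consequences S X) : Poly.rename g f ∈ consequences S Y := by
  have h := (Submodule.mem_sInf.1 hf) ((consequences S Y).comap (Poly.rename g)) ?_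
  · exact h
  constructor
  · intro o x y hy
    simp only [Submodule.mem_comap, Poly.rename_mul] at hy ⊢
    exact isIdeal_idealSpan _ _ o _ _ hy
  · rintro _ ⟨n, f, hf, φ, rfl⟩
    refine Submodule.mem_sInf.2 fun I hI => hI.2 ?_
    exact ⟨n, f, hf, fun i => Poly.rename g (φ i), Poly.rename_subst g φ f⟩

/-! ### The free associative interchange algebra -/

variable (F) in
/-- Associativity of both operations, and the interchange identity
`(a ∘ b) • (c ∘ d) = (a • c) ∘ (b • d)`. -/
inductive AssocInterchange : ∀ n : ℕ, Poly F (Fin n) → Prop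
  | assoc (o : Op) : AssocInterchange 3
      (Poly.mul F _ o (Poly.mul F _ o (Poly.var 0) (Poly.var 1)) (Poly.var 2)
        - Poly.mul F _ o (Poly.var 0) (Poly.mul F _ o (Poly.var 1) (Poly.var 2)))
  | interchange : AssocInterchange 4
      (Poly.mul F _ .bullet (Poly.mul F _ .circ (Poly.var 0) (Poly.var 1))
          (Poly.mul F _ .circ (Poly.var 2) (Poly.var 3))
        - Poly.mul F _ .circ (Poly.mul F _ .bullet (Poly.var 0) (Poly.var 2))
          (Poly.mul F _ .bullet (Poly.var 1) (Poly.var 3)))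

variable (F) in
/-- The ideal of the free algebra generated by all instances of associativity and interchange. -/
def interchangeIdeal (X : Type*) : Submodule F (Poly F X) :=
  consequences (fun n => {f | AssocInterchange F n f}) X

variable (F) in
/-- The free associative interchange algebra on `X`. -/
abbrev FreeAI (X : Type*) : Type _ := Poly F X ⧸ interchangeIdeal F X

variable (F) in
/-- The operations of the free associative interchange algebra, induced on the quotient by those of
the free algebra. -/
def FreeAI.op (X : Type*) : BilinOps F (FreeAI F X) := fun o =>
  (interchangeIdeal F X).liftQ
    ((Submodule.mapQLinear (interchangeIdeal F X) (interchangeIdeal F X)).comp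
      ((Poly.mul F X o).codRestrict (Submodule.compatibleMaps _ _)
        fun x y hy => (isIdeal_idealSpan _ _ o x y hy).1))
    (by
      intro x hx
      rw [LinearMap.mem_ker]
      refine Submodule.linearMap_qext _ (LinearMap.ext fun y => ?_)
      exact (Submodule.Quotient.mk_eq_zero _).2 (isIdeal_idealSpan _ _ o y x hx).2)

/-! ### Representations of the symmetric group -/

section SubQuot

variable {G V : Type*} [Group G] [AddCommGroup V] [Module F V]

/-- The quotient of `p` by `q` (more precisely, by the part of `q` that lies in `p`). -/
def SubQuot (p q : Submodule F V) : Type _ := p ⧸ q.submoduleOf p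

instance (p q : Submodule F V) : AddCommGroup (SubQuot p q) :=
  inferInstanceAs (AddCommGroup (p ⧸ q.submoduleOf p))

instance (p q : Submodule F V) : Module F (SubQuot p q) :=
  inferInstanceAs (Module F (p ⧸ q.submoduleOf p))

/-- The class of an element of `p`. -/
def SubQuot.mk {p q : Submodule F V} (v : V) (hv : v ∈ p) : SubQuot p q :=
  (q.submoduleOf p).mkQ ⟨v, hv⟩

/-- The representation induced on the quotient of two invariant subspaces. -/
def subQuotRep (ρ : Representation F G V) (p q : Submodule F V) (hp : ∀ g, p ≤ p.comap (ρ g))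
    (hq : ∀ g, q ≤ q.comap (ρ g)) : Representation F G (SubQuot p q) :=
  (ρ.subrepresentation p hp).quotient (q.submoduleOf p) fun g _ hv => hq g hv

end SubQuot

/-- The subrepresentation generated by a vector. -/
def generatedBy {G V : Type*} [Group G] [AddCommGroup V] [Module F V] (ρ : Representation F G V)
    (v : V) : Subrepresentation ρ where
  toSubmodule := Submodule.span F (Set.range fun g => ρ g v)
  apply_mem_toSubmodule g w hw := by
    induction hw using Submodule.span_induction with
    | mem x hx =>
      obtain ⟨h, rfl⟩ := hx
      refine Submodule.subset_span ⟨g * h, ?_⟩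
      simp
    | zero => simp
    | add x y _ _ hx hy => rw [map_add]; exact add_mem hx hy
    | smul c x _ hx => rw [map_smul]; exact Submodule.smul_mem _ c hx

variable (F) in
/-- The permutation representation of the symmetric group on `F ^ n`. -/
def naturalRep (n : ℕ) : Representation F (Equiv.Perm (Fin n)) (Fin n →₀ F) where
  toFun s := Finsupp.lmapDomain F F s
  map_one' := by
    refine Finsupp.lhom_ext' fun m => LinearMap.ext_ring ?_
    simp
  map_mul' s t := by
    refine Finsupp.lhom_ext' fun m => LinearMap.ext_ring ?_
    simp

variable (F) in
/-- The Specht module of the partition `(n - 1, 1)` of `n ≥ 2`. A tabloid of this shape is given by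
the single entry of its second row, so the permutation module on tabloids is `F ^ n`; the polytabloids
are the differences of two distinct basis vectors. -/
def spechtHook (n : ℕ) :
    Subrepresentation (naturalRep F n) where
  toSubmodule := Submodule.span F
    {v | ∃ i j : Fin n, i ≠ j ∧ v = Finsupp.single i 1 - Finsupp.single j 1}
  apply_mem_toSubmodule g w hw := by
    induction hw using Submodule.span_induction with
    | mem x hx =>
      obtain ⟨i, j, hij, rfl⟩ := hx
      exact Submodule.subset_span ⟨g i, g j, by simpa using hij, by simp [naturalRep, Finsupp.mapDomain_sub]⟩
    | zero => simp
    | add x y _ _ hx hy => rw [map_add]; exact add_mem hx hy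
    | smul c x _ hx => rw [map_smul]; exact Submodule.smul_mem _ c hx

/-! ### Multilinear identities of the two Jordan products -/

variable (F) in
/-- The multilinear polynomials of degree `n`: each of the `n` variables occurs exactly once in
each monomial. -/
def multilinear (n : ℕ) : Submodule F (Poly F (Fin n)) :=
  Finsupp.supported F F {m | m.IsMultilinear}

variable (F) in
/-- The multilinear identities of degree `n` satisfied by the two Jordan products in the free
associative interchange algebra on countably many generators. -/
def allIdentities (n : ℕ) : Submodule F (Poly F (Fin n)) where
  carrier := {f | f ∈ multilinear F n ∧ IsIdentity (jordan (FreeAI.op F ℕ)) f}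
  add_mem' := fun hf hg =>
    ⟨add_mem hf.1 hg.1, fun a => by rw [map_add, hf.2 a, hg.2 a, add_zero]⟩
  zero_mem' := ⟨zero_mem _, fun a => map_zero _⟩
  smul_mem' := fun c f hf =>
    ⟨Submodule.smul_mem _ c hf.1, fun a => by rw [map_smul, hf.2 a, smul_zero]⟩

variable (F) in
/-- The multilinear polynomials of degree `n` that are consequences of the multilinear identities
of the two Jordan products of degree less than `n`. -/
def oldIdentities (n : ℕ) : Submodule F (Poly F (Fin n)) :=
  multilinear F n ⊓ consequences (fun k => {f | k < n ∧ f ∈ allIdentities F k}) (Fin n)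

variable (F) in
/-- The symmetric group permutes the variables. -/
def permRep (n : ℕ) : Representation F (Equiv.Perm (Fin n)) (Poly F (Fin n)) where
  toFun s := Poly.rename s
  map_one' := by
    refine Finsupp.lhom_ext' fun m => LinearMap.ext_ring ?_
    simp [Poly.rename, Mon.map_id, Equiv.Perm.coe_one]
  map_mul' s t := by
    refine Finsupp.lhom_ext' fun m => LinearMap.ext_ring ?_
    simp [Poly.rename, Mon.map_map, Equiv.Perm.coe_mul]

theorem permRep_mem_multilinear {n : ℕ} (s : Equiv.Perm (Fin n)) {f : Poly F (Fin n)}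
    (hf : f ∈ multilinear F n) : permRep F n s f ∈ multilinear F n := by
  classical
  rw [multilinear, Finsupp.mem_supported] at *
  intro m hm
  obtain ⟨m', hm', rfl⟩ := Finset.mem_image.1 (Finsupp.mapDomain_support hm)
  intro x
  rw [Mon.count_map]
  exact hf hm' _

theorem permRep_mem_all {n : ℕ} (s : Equiv.Perm (Fin n)) :
    allIdentities F n ≤ (allIdentities F n).comap (permRep F n s) := fun f hf =>
  ⟨permRep_mem_multilinear s hf.1, fun a =>
    (Poly.eval_rename (jordan (FreeAI.op F ℕ)) a s f).trans (hf.2 _)⟩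

theorem permRep_mem_old {n : ℕ} (s : Equiv.Perm (Fin n)) :
    oldIdentities F n ≤ (oldIdentities F n).comap (permRep F n s) := fun _ hf =>
  ⟨permRep_mem_multilinear s hf.1, rename_mem_consequences _ _ hf.2⟩

variable (F) in
/-- The quotient space of all identities of degree `n` by the old ones. -/
abbrev NewIdentities (n : ℕ) : Type _ := SubQuot (allIdentities F n) (oldIdentities F n)

variable (F) in
/-- The action of the symmetric group on the new identities. -/
def newRep (n : ℕ) : Representation F (Equiv.Perm (Fin n)) (NewIdentities F n) :=
  subQuotRep (permRep F n) (allIdentities F n) (oldIdentities F n) permRep_mem_all permRep_mem_old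

/-- The class of an identity modulo the old identities. -/
def newClass {n : ℕ} (f : Poly F (Fin n)) (hf : f ∈ allIdentities F n) : NewIdentities F n :=
  SubQuot.mk f hf

/-! ### The identities

In the following polynomials the operation symbols stand for the two Jordan products. -/

open Classical in
/-- The complete linearization of `f` with respect to `p : Fin n → X`: replace every variable `x` by
the sum of the new variables `i` with `p i = x`, and keep the multilinear component. -/
def linearize {n : ℕ} {X : Type*} (p : Fin n → X) (f : Poly F X) : Poly F (Fin n) :=
  (Poly.subst (fun x => ∑ i with p i = x, Poly.var i) f).filter Mon.IsMultilinear

variable (F) in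
/-- Commutativity `{a, b} = {b, a}`. -/
def commutativity (o : Op) : Poly F (Fin 2) :=
  Poly.mul F _ o (Poly.var 0) (Poly.var 1) - Poly.mul F _ o (Poly.var 1) (Poly.var 0)

variable (F) in
/-- The Jordan identity `{a, {b, {a, a}}} = {{a, b}, {a, a}}`. -/
def jordanIdentity (o : Op) : Poly F (Fin 2) :=
  let a : Poly F (Fin 2) := Poly.var 0
  let b : Poly F (Fin 2) := Poly.var 1
  let J := Poly.mul F (Fin 2) o
  J a (J b (J a a)) - J (J a b) (J a a)

variable (F) in
/-- The new identity of degree four, in the variable `a`: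
`{{a, a}∘, {a, a}∘}• = {{a, a}•, {a, a}•}∘`. -/
def newJJ4 : Poly F (Fin 1) :=
  let a : Poly F (Fin 1) := Poly.var 0
  let c := Poly.mul F (Fin 1) .circ
  let d := Poly.mul F (Fin 1) .bullet
  d (c a a) (c a a) - c (d a a) (d a a)

variable (F) in
/-- The first new identity of degree five, in the variables `a, b`:
`{{a, b}∘, {a, {a, a}∘}∘}• = {{a, a}•, {b, {a, a}∘}•}∘`. -/
def newJJ51 : Poly F (Fin 2) :=
  let a : Poly F (Fin 2) := Poly.var 0
  let b : Poly F (Fin 2) := Poly.var 1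
  let c := Poly.mul F (Fin 2) .circ
  let d := Poly.mul F (Fin 2) .bullet
  d (c a b) (c a (c a a)) - c (d a a) (d b (c a a))

variable (F) in
/-- The second new identity of degree five, in the variables `a, b`:
`{{a, a}∘, {b, {a, a}•}∘}• = {{a, b}•, {a, {a, a}•}•}∘`. -/
def newJJ52 : Poly F (Fin 2) :=
  let a : Poly F (Fin 2) := Poly.var 0
  let b : Poly F (Fin 2) := Poly.var 1
  let c := Poly.mul F (Fin 2) .circ
  let d := Poly.mul F (Fin 2) .bullet
  d (c a a) (c b (d a a)) - c (d a b) (d a (d a a))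

variable (F) in
/-- The linearization of `newJJ51`. -/
def linJJ51 : Poly F (Fin 5) := linearize (![0, 0, 0, 0, 1] : Fin 5 → Fin 2) (newJJ51 F)

variable (F) in
/-- The linearization of `newJJ52`. -/
def linJJ52 : Poly F (Fin 5) := linearize (![0, 0, 0, 0, 1] : Fin 5 → Fin 2) (newJJ52 F)

variable (F) in
/-- The identities of degree at most four: commutativity and the linearized Jordan identity for
each Jordan product, and the linearization of `newJJ4`. -/
inductive LowerList : ∀ n : ℕ, Poly F (Fin n) → Prop
  | comm (o : Op) : LowerList 2 (commutativity F o)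
  | jordan (o : Op) :
      LowerList 4 (linearize (![0, 0, 0, 1] : Fin 4 → Fin 2) (jordanIdentity F o))
  | new4 : LowerList 4 (linearize (fun _ : Fin 4 => (0 : Fin 1)) (newJJ4 F))

variable (F) in
/-- The identities of degree at most four together with the two linearized new identities of degree
five. -/
inductive FullList : ∀ n : ℕ, Poly F (Fin n) → Prop
  | lower {n : ℕ} {f : Poly F (Fin n)} (h : LowerList F n f) : FullList n f
  | new51 : FullList 5 (linJJ51 F)
  | new52 : FullList 5 (linJJ52 F)

end Field

end JJ

end

open JJ

/-!
Expand the Jordan products in the free associative interchange algebra: a Jordan monomial `m`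
becomes a combination `E m` of monomials in two associative operations, and a multilinear `f` is an
identity iff `E f` lies in the ideal of associativity and interchange. In the other direction,
symmetrization `S` sends the monomials of degree at most five back to Jordan polynomials, such that

* `S` maps the ideal to consequences of the identities of degree at most four;
* `S (E m) - k • m`, for a positive integer `k` that depends only on the degree, is a consequence
  of those identities, except in degree five, where the new identities have to be added.

Hence `k • f = S (E f) - (S (E f) - k • f)` is a consequence of the listed identities whenever `f`
is an identity. Both properties of `S` are finite computations with integral coefficients.

Each new identity has a distinguished variable and is symmetric in the other ones. The sum of its
five permuted copies is a consequence of the identities of degree four, so that the submodule it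
generates is a quotient of the simple module `[41]`. An algebra of dimension eight satisfies all
identities of degree at most four and the second new identity but not the first one, and conversely
for the same algebra with its two operations exchanged: both quotients are nonzero, and their sum is
direct.
-/

namespace JJ

/-! ### Monomials -/

namespace Op

/-- The other operation symbol: most constructions below are symmetric under its exchange. -/
def other : Op → Op
  | circ => bullet
  | bullet => circ

instance : BEq Op where
  beq
    | circ, circ => true
    | bullet, bullet => true
    | _, _ => false

instance : LawfulBEq Op where
  eq_of_beq {o p} h := by cases o <;> cases p <;> first | rfl | cases h
  rfl {o} := by cases o <;> rfl

end Op

namespace Mon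

variable {X Y : Type*}

/-- Boolean equality of monomials, written so that the kernel evaluates it quickly. -/
protected def beq [BEq X] : Mon X → Mon X → Bool
  | var x, var y => x == y
  | mul o l r, mul p l' r' => o == p && (l.beq l' && r.beq r')
  | _, _ => false

instance [BEq X] : BEq (Mon X) := ⟨Mon.beq⟩

instance [BEq X] [LawfulBEq X] : LawfulBEq (Mon X) where
  eq_of_beq {m n} (h : m.beq n = true) := by
    induction m generalizing n with
    | var x =>
      cases n with
      | var y => exact congrArg var (eq_of_beq h)
      | mul => simp [Mon.beq] at h
    | mul o l r hl hr =>
      cases n with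
      | var => simp [Mon.beq] at h
      | mul p l' r' =>
        simp only [Mon.beq, Bool.and_eq_true, beq_iff_eq] at h
        rw [h.1, hl h.2.1, hr h.2.2]
  rfl {m} := by
    change m.beq m = true
    induction m with
    | var x => simp [Mon.beq]
    | mul o l r hl hr => simp [Mon.beq, hl, hr]

/-- Equality of monomials modulo commutativity of both operations. -/
inductive CommEq : Mon X → Mon X → Prop
  | refl (m : Mon X) : CommEq m m
  | mul (o : Op) {l r l' r' : Mon X} (hl : CommEq l l') (hr : CommEq r r') :
      CommEq (mul o l r) (mul o l' r')
  | comm (o : Op) {l r l' r' : Mon X} (hl : CommEq l r') (hr : CommEq r l') :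
      CommEq (mul o l r) (mul o l' r')

theorem CommEq.map (g : X → Y) {m n : Mon X} (h : CommEq m n) : CommEq (m.map g) (n.map g) := by
  induction h with
  | refl m => exact .refl _
  | mul o _ _ hl hr => exact .mul o hl hr
  | comm o _ _ hl hr => exact .comm o hl hr

/-- Boolean version of `CommEq`. -/
def beqComm [BEq X] : Mon X → Mon X → Bool
  | var x, var y => x == y
  | mul o l r, mul p l' r' =>
    o == p && ((l.beqComm l' && r.beqComm r') || (l.beqComm r' && r.beqComm l'))
  | _, _ => false

theorem commEq_of_beqComm [BEq X] [LawfulBEq X] {m n : Mon X} (h : m.beqComm n = true) :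
    CommEq m n := by
  induction m generalizing n with
  | var x =>
    cases n with
    | var y => rw [eq_of_beq (a := x) h]; exact .refl _
    | mul => simp [beqComm] at h
  | mul o l r hl hr =>
    cases n with
    | var => simp [beqComm] at h
    | mul p l' r' =>
      simp only [beqComm, Bool.and_eq_true, Bool.or_eq_true, beq_iff_eq] at h
      obtain ⟨rfl, h | h⟩ := h
      · exact .mul _ (hl h.1) (hr h.2)
      · exact .comm _ (hl h.1) (hr h.2)

/-- The degree of a monomial, that is, its number of leaves. -/
def size : Mon X → ℕ
  | var _ => 1
  | mul _ l r => l.size + r.size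

theorem size_pos (m : Mon X) : 0 < m.size := by
  induction m with
  | var _ => exact Nat.one_pos
  | mul _ l _ hl _ => exact Nat.add_pos_left hl _

@[simp]
theorem size_map (g : X → Y) (m : Mon X) : (m.map g).size = m.size := by
  induction m with
  | var x => rfl
  | mul o l r hl hr => simp [map, size, hl, hr]

/-- The variables of a monomial, from left to right. -/
def leaves : Mon X → List X
  | var x => [x]
  | mul _ l r => l.leaves ++ r.leaves

theorem length_leaves (m : Mon X) : m.leaves.length = m.size := by
  induction m with
  | var x => rfl
  | mul o l r hl hr => simp [leaves, size, hl, hr]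

theorem leaves_map (g : X → Y) (m : Mon X) : (m.map g).leaves = m.leaves.map g := by
  induction m with
  | var x => rfl
  | mul o l r hl hr => simp [map, leaves, hl, hr]

/-- The leftmost variable of a monomial. -/
def first : Mon X → X
  | var x => x
  | mul _ l _ => l.first

theorem first_map (g : X → Y) (m : Mon X) : (m.map g).first = g m.first := by
  induction m with
  | var x => rfl
  | mul o l r hl _ => simp [map, first, hl]

/-- The `i`-th variable of a monomial, or the leftmost one if there are at most `i`. -/
def leaf (m : Mon X) (i : ℕ) : X := m.leaves.getD i m.first

theorem leaf_map (g : X → Y) (m : Mon X) (i : ℕ) : (m.map g).leaf i = g (m.leaf i) := by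
  simp only [leaf, leaves_map, first_map, List.getD_map]

/-- Substitution of monomials for the variables. -/
def bind (f : X → Mon Y) : Mon X → Mon Y
  | var x => f x
  | mul o l r => mul o (l.bind f) (r.bind f)

/-- Exchange of the two operation symbols. -/
def swap : Mon X → Mon X
  | var x => var x
  | mul o l r => mul o.other l.swap r.swap

/-! ### Numbered monomials -/

/-- The shape of a monomial: its variables are replaced by consecutive numbers, starting
with `k`. -/
def relabel : ℕ → Mon X → Mon ℕ
  | k, var _ => var k
  | k, mul o l r => mul o (l.relabel k) (r.relabel (k + l.size))

theorem relabel_map (g : X → Y) (m : Mon X) (k : ℕ) : (m.map g).relabel k = m.relabel k := by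
  induction m generalizing k with
  | var x => rfl
  | mul o l r hl hr => simp [map, relabel, hl, hr]

@[simp]
theorem size_relabel (m : Mon X) (k : ℕ) : (m.relabel k).size = m.size := by
  induction m generalizing k with
  | var x => rfl
  | mul o l r hl hr => simp [relabel, size, hl, hr]

theorem map_relabel_of_getElem_leaves (m : Mon X) (k : ℕ) (g : ℕ → X)
    (hg : ∀ i (hi : i < m.leaves.length), g (k + i) = m.leaves[i]) :
    (m.relabel k).map g = m := by
  induction m generalizing k with
  | var x => simpa [relabel, map, leaves] using hg 0 (by simp [leaves])
  | mul o l r hl hr =>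
    simp only [relabel, map]
    rw [hl k fun i hi => ?_, hr _ fun i hi => ?_]
    · rw [add_assoc, ← length_leaves, hg _ (by simpa [leaves] using hi)]
      simp [leaves]
    · rw [hg i (by simp [leaves]; omega)]
      simp [leaves, List.getElem_append_left hi]

theorem map_relabel (m : Mon X) : (m.relabel 0).map m.leaf = m :=
  map_relabel_of_getElem_leaves m 0 _ fun i hi => by
    rw [zero_add, leaf, List.getD_eq_getElem _ _ hi]

/-- All monomials with `n` leaves numbered `k, k + 1, …` from left to right; the first argument
bounds the height. -/
def shapes : ℕ → ℕ → ℕ → List (Mon ℕ)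
  | 0, _, _ => []
  | d + 1, n, k =>
    bif n == 1 then [var k] else
      (List.range n).flatMap fun i => (shapes d i k).flatMap fun l =>
        (shapes d (n - i) (k + i)).flatMap fun r => [mul .circ l r, mul .bullet l r]

theorem relabel_mem_shapes (m : Mon X) {d : ℕ} (k : ℕ) (hd : m.size ≤ d) :
    m.relabel k ∈ shapes d m.size k := by
  induction m generalizing d k with
  | var x =>
    obtain ⟨d, rfl⟩ := Nat.exists_eq_add_of_le' hd
    simp [relabel, shapes, size]
  | mul o l r hl hr =>
    have hl₀ := l.size_pos
    have hr₀ := r.size_pos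
    simp only [size] at hd
    obtain ⟨d, rfl⟩ : ∃ e, d = e + 1 := ⟨d - 1, by omega⟩
    have hn : (l.size + r.size == 1) = false := by simp; omega
    simp only [relabel, shapes, size, hn, cond_false, List.mem_flatMap]
    refine ⟨l.size, by simp; omega, _, hl k (by omega), r.relabel (k + l.size), ?_, ?_⟩
    · rw [Nat.add_sub_cancel_left]
      exact hr _ (by omega)
    · cases o <;> simp

/-! ### Representatives modulo commutativity -/

/-- The number by which the two factors of a product are ordered in `orient`. -/
def weight : Mon X → ℕ
  | var _ => 2
  | mul .circ l r => 2 * (l.size + r.size)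
  | mul .bullet l r => 2 * (l.size + r.size) + 1

theorem weight_relabel (m : Mon X) (k : ℕ) : (m.relabel k).weight = m.weight := by
  rcases m with _ | ⟨_ | _, _, _⟩ <;> simp [relabel, weight]

/-- The product of `l` and `r` in the order of their weights. -/
def orientedMul (o : Op) (l r : Mon X) : Mon X :=
  bif Nat.ble l.weight r.weight then mul o l r else mul o r l

/-- A representative of a monomial modulo commutativity. Since it depends on the shape of the
monomial alone, it commutes with renaming; it reduces the number of shapes to be checked. -/
def orient : Mon X → Mon X
  | var x => var x
  | mul o l r => orientedMul o l.orient r.orient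

theorem commEq_orient (m : Mon X) : CommEq m.orient m := by
  induction m with
  | var x => exact .refl _
  | mul o l r hl hr =>
    simp only [orient, orientedMul]
    cases Nat.ble l.orient.weight r.orient.weight
    · exact .comm _ hr hl
    · exact .mul _ hl hr

theorem size_orient (m : Mon X) : m.orient.size = m.size := by
  induction m with
  | var x => rfl
  | mul o l r hl hr =>
    simp only [orient, orientedMul]
    cases Nat.ble l.orient.weight r.orient.weight <;> simp [size, hl, hr, add_comm]

/-- The factors of every product stand in the order of their weights. -/
def IsOriented : Mon X → Prop
  | var _ => True
  | mul _ l r => l.IsOriented ∧ r.IsOriented ∧ l.weight ≤ r.weight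

theorem isOriented_orient (m : Mon X) : m.orient.IsOriented := by
  induction m with
  | var _ => trivial
  | mul o l r hl hr =>
    simp only [orient, orientedMul]
    cases h : Nat.ble l.orient.weight r.orient.weight
    · exact ⟨hr, hl, (not_le.1 fun h' => by simp [Nat.ble_eq_true_of_le h'] at h).le⟩
    · exact ⟨hl, hr, Nat.le_of_ble_eq_true h⟩

theorem IsOriented.relabel {m : Mon X} (h : m.IsOriented) (k : ℕ) :
    (m.relabel k).IsOriented := by
  induction m generalizing k with
  | var x => trivial
  | mul o l r hl hr =>
    exact ⟨hl h.1 _, hr h.2.1 _, by simpa only [weight_relabel] using h.2.2⟩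

theorem IsOriented.orient_eq {m : Mon X} (h : m.IsOriented) : m.orient = m := by
  induction m with
  | var x => rfl
  | mul o l r hl hr =>
    simp only [orient, orientedMul, hl h.1, hr h.2.1, Nat.ble_eq_true_of_le h.2.2, cond_true]

/-! ### Rewriting and expansion of monomials -/

/-- Associativity applied at the root. -/
def assocStep : Op → Mon X → Mon X → List (Mon X)
  | .circ, mul .circ a b, r => [mul .circ a (mul .circ b r)]
  | .bullet, mul .bullet a b, r => [mul .bullet a (mul .bullet b r)]
  | _, _, _ => []

theorem assocStep_map (g : X → Y) (o : Op) (l r : Mon X) :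
    assocStep o (l.map g) (r.map g) = (assocStep o l r).map (map g) := by
  cases o <;> rcases l with x | ⟨_ | _, a, b⟩ <;> rfl

/-- The interchange identity applied at the root. -/
def interchangeStep : Op → Mon X → Mon X → List (Mon X)
  | .bullet, mul .circ a b, mul .circ c d => [mul .circ (mul .bullet a c) (mul .bullet b d)]
  | _, _, _ => []

theorem interchangeStep_map (g : X → Y) (o : Op) (l r : Mon X) :
    interchangeStep o (l.map g) (r.map g) = (interchangeStep o l r).map (map g) := by
  cases o <;> rcases l with x | ⟨_ | _, a, b⟩ <;> rcases r with y | ⟨_ | _, c, d⟩ <;> rfl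

/-- The monomials obtained by one application of associativity or of the interchange identity. -/
def steps : Mon X → List (Mon X)
  | var _ => []
  | mul o l r =>
    l.steps.map (fun l' => mul o l' r) ++ (r.steps.map (mul o l) ++
      (assocStep o l r ++ interchangeStep o l r))

theorem steps_map (g : X → Y) (m : Mon X) : (m.map g).steps = m.steps.map (map g) := by
  induction m with
  | var x => rfl
  | mul o l r hl hr =>
    simp [map, steps, hl, hr, assocStep_map, interchangeStep_map, Function.comp_def]

theorem size_of_mem_steps {m n : Mon X} (h : n ∈ m.steps) : n.size = m.size := by
  induction m generalizing n with
  | var x => simp [steps] at h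
  | mul o l r hl hr =>
    simp only [steps, List.mem_append, List.mem_map] at h
    rcases h with ⟨l', h, rfl⟩ | ⟨r', h, rfl⟩ | h | h
    · simp [size, hl h]
    · simp [size, hr h]
    · cases o <;> rcases l with x | ⟨_ | _, a, b⟩ <;> simp only [assocStep, List.mem_singleton,
        List.not_mem_nil] at h <;> subst h <;> simp [size, add_assoc]
    · cases o <;> rcases l with x | ⟨_ | _, a, b⟩ <;> rcases r with y | ⟨_ | _, c, d⟩ <;>
        simp only [interchangeStep, List.mem_singleton, List.not_mem_nil] at h
      subst h
      simp only [size]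
      omega

/-- The terms of the expansion of a monomial in the Jordan products. -/
def expand : Mon X → List (Mon X)
  | var x => [var x]
  | mul o l r => l.expand.flatMap fun a => r.expand.flatMap fun b => [mul o a b, mul o b a]

theorem expand_map (g : X → Y) (m : Mon X) : (m.map g).expand = m.expand.map (map g) := by
  induction m with
  | var x => rfl
  | mul o l r hl hr => simp [map, expand, hl, hr, List.flatMap_map, List.map_flatMap]

theorem size_of_mem_expand {m n : Mon X} (h : n ∈ m.expand) : n.size = m.size := by
  induction m generalizing n with
  | var x => rw [List.mem_singleton.1 h]
  | mul o l r hl hr =>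
    simp only [expand, List.mem_flatMap, List.mem_cons, List.not_mem_nil, or_false] at h
    obtain ⟨a, ha, b, hb, rfl | rfl⟩ := h
    · simp [size, hl ha, hr hb]
    · simp [size, hl ha, hr hb, add_comm]

end Mon

/-! ### Formal combinations and their polynomials -/

theorem Poly.mul_single_single {F : Type*} [Field F] {X : Type*} (o : Op) (m n : Mon X) :
    Poly.mul F X o (Finsupp.single m 1) (Finsupp.single n 1) =
      Finsupp.single (Mon.mul o m n) 1 := by
  simp [Poly.mul]

/-- Formal integral combinations of monomials, as lists of terms. In contrast to polynomials,
the kernel can compute with them. -/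
abbrev Comb (X : Type*) : Type _ := List (ℤ × Mon X)

namespace Comb

open Mon

variable {X Y V W : Type*} [AddCommGroup V] [AddCommGroup W]

/-- A monomial as a combination. -/
def of (m : Mon X) : Comb X := [(1, m)]

/-- Multiplication by an integer. -/
def scale (k : ℤ) (l : Comb X) : Comb X := l.map fun p => (k * p.1, p.2)

/-- The effect of a function on all monomials of a combination. -/
def mapMon (g : Mon X → Mon Y) (l : Comb X) : Comb Y := l.map fun p => (p.1, g p.2)

theorem mapMon_mapMon {Z : Type*} (h : Mon Y → Mon Z) (g : Mon X → Mon Y) (l : Comb X) :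
    (l.mapMon g).mapMon h = l.mapMon (h ∘ g) := by
  simp [mapMon]

/-- The product of two combinations. -/
def mul (o : Op) (p q : Comb X) : Comb X :=
  p.flatMap fun a => q.map fun b => (a.1 * b.1, Mon.mul o a.2 b.2)

/-- The value of a combination, given the values of the monomials. -/
def val (v : Mon X → V) (l : Comb X) : V := (l.map fun p => p.1 • v p.2).sum

section

variable (v : Mon X → V)

@[simp]
theorem val_nil : val v [] = 0 := rfl

@[simp]
theorem val_cons (p : ℤ × Mon X) (l : Comb X) : val v (p :: l) = p.1 • v p.2 + val v l := by
  simp [val]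

@[simp]
theorem val_append (l l' : Comb X) : val v (l ++ l') = val v l + val v l' := by
  simp [val]

@[simp]
theorem val_scale (k : ℤ) (l : Comb X) : val v (l.scale k) = k • val v l := by
  simp [val, scale, mul_smul, List.smul_sum, Function.comp_def]

@[simp]
theorem val_mapMon (v : Mon Y → V) (g : Mon X → Mon Y) (l : Comb X) :
    val v (l.mapMon g) = val (v ∘ g) l := by
  simp [val, mapMon, Function.comp_def]

theorem val_flatMap {A : Type*} (f : A → Comb X) (l : List A) :
    val v (l.flatMap f) = (l.map fun a => val v (f a)).sum := by
  induction l with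
  | nil => rfl
  | cons a l h => simp [h]

theorem map_val {G : Type*} [FunLike G V W] [AddMonoidHomClass G V W] (f : G) (l : Comb X) :
    f (val v l) = val (f ∘ v) l := by
  simp [val, map_list_sum, Function.comp_def]

end

variable (F : Type*) [Field F]

/-- The polynomial given by a combination. -/
noncomputable def toPoly (l : Comb X) : Poly F X := val (fun m => Finsupp.single m 1) l

variable {F}

theorem eval_toPoly {A : Type*} [AddCommGroup A] [Module F A] (op : BilinOps F A) (a : X → A)
    (l : Comb X) : (toPoly F l).eval op a = val (Mon.eval (fun o x y => op o x y) a) l := by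
  simp [toPoly, map_val, Poly.eval, Function.comp_def]

theorem rename_toPoly (g : X → Y) (l : Comb X) :
    Poly.rename g (toPoly F l) = toPoly F (l.mapMon (Mon.map g)) := by
  simp [toPoly, map_val, Poly.rename, Function.comp_def]

theorem toPoly_append (l l' : Comb X) : toPoly F (l ++ l') = toPoly F l + toPoly F l' := by
  simp [toPoly]

theorem toPoly_scale (k : ℤ) (l : Comb X) : toPoly F (l.scale k) = k • toPoly F l := by
  simp [toPoly]

theorem toPoly_mul (o : Op) (p q : Comb X) :
    toPoly F (mul o p q) = Poly.mul F X o (toPoly F p) (toPoly F q) := by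
  have monomial_mul (a : ℤ × Mon X) :
      toPoly F (q.map fun b => (a.1 * b.1, Mon.mul o a.2 b.2)) =
        a.1 • Poly.mul F X o (Finsupp.single a.2 1) (toPoly F q) := by
    rw [toPoly, toPoly, map_val]
    simp only [val, List.map_map, List.smul_sum, Function.comp_def, mul_smul,
      Poly.mul_single_single]
  calc toPoly F (mul o p q)
      = val (fun m => Poly.mul F X o (Finsupp.single m 1) (toPoly F q)) p := by
        simp only [mul, toPoly, val_flatMap] at monomial_mul ⊢
        simp only [monomial_mul]
        rfl
    _ = (Poly.mul F X o).flip (toPoly F q) (toPoly F p) := by rw [toPoly, toPoly, map_val]; rfl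

theorem subst_toPoly (f : X → Mon Y) (l : Comb X) :
    Poly.subst (fun x => Finsupp.single (f x) 1) (toPoly F l) =
      toPoly F (l.mapMon (Mon.bind f)) := by
  have eval_eq (m : Mon X) :
      m.eval (fun o x y => Poly.mul F Y o x y) (fun x => Finsupp.single (f x) 1) =
        Finsupp.single (m.bind f) 1 := by
    induction m with
    | var x => rfl
    | mul o l r hl hr => rw [Mon.eval, hl, hr, Poly.mul_single_single, Mon.bind]
  rw [Poly.subst, eval_toPoly]
  simp only [toPoly, val_mapMon]
  exact congrArg (val · l) (funext eval_eq)

/-! ### A zero test for combinations -/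

/-- Search trees for the terms of a combination, ordered by a numerical invariant of the
monomials. -/
inductive Tree
  | leaf : Tree
  | node (s t : Tree) (h : ℕ) (k : ℤ) (m : Mon ℕ) : Tree

namespace Tree

/-- Add the term `k • m` with invariant `h` to a search tree; terms that are equal in the sense
of `e` are collected. -/
def insert (e : Mon ℕ → Mon ℕ → Bool) (h : ℕ) (k : ℤ) (m : Mon ℕ) : Tree → Tree
  | leaf => node leaf leaf h k m
  | node s t h' k' m' =>
    bif Nat.beq h h' && e m m' then node s t h' (k + k') m'
    else bif Nat.ble h h' then node (s.insert e h k m) t h' k' m'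
    else node s (t.insert e h k m) h' k' m'

/-- All coefficients are zero. -/
def isZero : Tree → Bool
  | leaf => true
  | node s t _ k _ => k == 0 && (s.isZero && t.isZero)

/-- The value of the combination of all terms in a search tree. -/
def val (v : Mon ℕ → V) : Tree → V
  | leaf => 0
  | node s t _ k m => k • v m + (s.val v + t.val v)

theorem val_insert {v : Mon ℕ → V} {e : Mon ℕ → Mon ℕ → Bool}
    (he : ∀ m n, e m n = true → v m = v n) (h : ℕ) (k : ℤ) (m : Mon ℕ) (t : Tree) :
    (t.insert e h k m).val v = k • v m + t.val v := by
  induction t with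
  | leaf => simp [insert, val]
  | node s t h' k' m' hs ht =>
    simp only [insert]
    rcases hb : (Nat.beq h h' && e m m') with _ | _
    · cases Nat.ble h h' <;> simp only [cond_false, cond_true, val, hs, ht] <;> abel
    · have hv := he m m' (Bool.and_eq_true_iff.1 hb).2
      simp only [cond_true, val, hv, add_smul]
      abel

theorem val_eq_zero (v : Mon ℕ → V) {t : Tree} (h : t.isZero = true) : t.val v = 0 := by
  induction t with
  | leaf => rfl
  | node s t _ k m hs ht =>
    simp only [isZero, Bool.and_eq_true, beq_iff_eq] at h
    simp [val, h.1, hs h.2.1, ht h.2.2]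

end Tree

/-- The number `n` passed to `f`. The case distinction makes the kernel evaluate `n` once, before
it is substituted into `f`. -/
def force {A : Type*} (n : ℕ) (f : ℕ → A) : A :=
  match n with
  | 0 => f 0
  | k + 1 => f (k + 1)

theorem force_eq {A : Type*} (n : ℕ) (f : ℕ → A) : force n f = f n := by
  cases n <;> rfl

/-- The search tree that collects the terms of a combination that are equal in the sense of `e`,
ordered by the invariant `h`. -/
def collect (h : Mon ℕ → ℕ) (e : Mon ℕ → Mon ℕ → Bool) : Comb ℕ → Tree
  | [] => .leaf
  | p :: l => force (h p.2) fun n => (collect h e l).insert e n p.1 p.2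

theorem val_collect {v : Mon ℕ → V} (h : Mon ℕ → ℕ) {e : Mon ℕ → Mon ℕ → Bool}
    (he : ∀ m n, e m n = true → v m = v n) (l : Comb ℕ) : (l.collect h e).val v = val v l := by
  induction l with
  | nil => rfl
  | cons p l ih => simp only [collect, force_eq, Tree.val_insert he, ih, val_cons]

/-- A numerical invariant of monomials. It only has to separate many of them, since the test
below compares monomials whose invariants agree. -/
def hash : Mon ℕ → ℕ
  | .var x => x + 1
  | .mul .circ l r => 3 * hash l + 5 * hash r + hash l * hash r
  | .mul .bullet l r => 4 * hash l + 7 * hash r + hash l * hash r + 1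

/-- A numerical invariant of monomials modulo commutativity, for the same purpose as `hash`. -/
def hashComm : Mon ℕ → ℕ
  | .var x => x + 1
  | .mul .circ l r => 3 * (hashComm l + hashComm r) + hashComm l * hashComm r
  | .mul .bullet l r => 5 * (hashComm l + hashComm r) + hashComm l * hashComm r + 1

/-- The combination is zero. -/
def isZero (l : Comb ℕ) : Bool := (l.collect hash (· == ·)).isZero

theorem val_eq_zero (v : Mon ℕ → V) {l : Comb ℕ} (h : l.isZero = true) : val v l = 0 := by
  rw [← val_collect hash (e := (· == ·)) fun m n hmn => congrArg v (eq_of_beq hmn)]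
  exact Tree.val_eq_zero v h

/-- The combination is zero modulo commutativity of both operations. -/
def isZeroComm (l : Comb ℕ) : Bool := (l.collect hashComm beqComm).isZero

theorem val_eq_zero_of_comm {v : Mon ℕ → V} (hv : ∀ m n, CommEq m n → v m = v n)
    {l : Comb ℕ} (h : l.isZeroComm = true) : val v l = 0 := by
  rw [← val_collect hashComm fun m n hmn => hv m n (commEq_of_beqComm hmn)]
  exact Tree.val_eq_zero v h

end Comb

/-! ### Substitution and consequences -/

section Polynomials

variable {F : Type*} [Field F]

namespace Poly

variable {X Y A : Type*} [AddCommGroup A] [Module F A]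

theorem eval_var (op : BilinOps F A) (a : X → A) (x : X) : (var x : Poly F X).eval op a = a x := by
  simp [eval, var, Mon.eval]

theorem eval_single (op : BilinOps F A) (a : X → A) (m : Mon X) :
    eval op a (Finsupp.single m (1 : F)) = m.eval (fun o x y => op o x y) a := by
  simp [eval]

theorem eval_mul (op : BilinOps F A) (a : X → A) (o : Op) (p q : Poly F X) :
    (mul F X o p q).eval op a = op o (p.eval op a) (q.eval op a) := by
  have h : (mul F X o).compr₂ (eval op a) = (op o).compl₁₂ (eval op a) (eval op a) := by
    ext m m'
    simp [mul, eval, Mon.eval]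
  simpa using LinearMap.congr_fun₂ h p q

theorem eval_subst (op : BilinOps F A) (a : Y → A) (φ : X → Poly F Y) (f : Poly F X) :
    (subst φ f).eval op a = f.eval op fun x => (φ x).eval op a := by
  have h : (eval op a).comp (subst φ) = eval op fun x => (φ x).eval op a := by
    refine Finsupp.lhom_ext' fun m => LinearMap.ext_ring ?_
    simp only [LinearMap.comp_apply, Finsupp.lsingle_apply, subst, eval_single]
    induction m with
    | var x => rfl
    | mul o l r hl hr => simp only [Mon.eval, eval_mul, hl, hr]
  exact LinearMap.congr_fun h f

theorem subst_var (φ : X → Poly F Y) (x : X) : subst φ (var x) = φ x := eval_var _ _ _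

theorem subst_mul (φ : X → Poly F Y) (o : Op) (p q : Poly F X) :
    subst φ (mul F X o p q) = mul F Y o (subst φ p) (subst φ q) := eval_mul _ _ _ _ _

theorem rename_single (g : X → Y) (m : Mon X) :
    rename g (Finsupp.single m (1 : F)) = Finsupp.single (m.map g) 1 := by
  simp [rename]

theorem subst_var_eq_self (f : Poly F X) : subst var f = f := by
  have h : subst var = LinearMap.id (R := F) (M := Poly F X) := by
    refine Finsupp.lhom_ext' fun m => LinearMap.ext_ring ?_
    simp only [LinearMap.comp_apply, Finsupp.lsingle_apply, subst, eval_single, LinearMap.id_apply]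
    induction m with
    | var x => rfl
    | mul o l r hl hr => rw [Mon.eval, hl, hr, mul_single_single]
  exact LinearMap.congr_fun h f

end Poly

section Consequences

variable {S S' : ∀ n : ℕ, Set (Poly F (Fin n))} {X Y : Type*}

theorem subst_mem_consequences {n : ℕ} {f : Poly F (Fin n)} (hf : f ∈ S n) (φ : Fin n → Poly F X) :
    Poly.subst φ f ∈ consequences S X :=
  Submodule.mem_sInf.2 fun _ hI => hI.2 ⟨n, f, hf, φ, rfl⟩

theorem mem_consequences {n : ℕ} {f : Poly F (Fin n)} (hf : f ∈ S n) :
    f ∈ consequences S (Fin n) := by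
  simpa only [Poly.subst_var_eq_self] using subst_mem_consequences hf Poly.var

theorem consequences_le {I : Submodule F (Poly F X)} (hI : IsIdeal (Poly.mul F X) I)
    (h : ∀ n, ∀ f ∈ S n, ∀ φ : Fin n → Poly F X, Poly.subst φ f ∈ I) : consequences S X ≤ I := by
  refine sInf_le ⟨hI, ?_⟩
  rintro _ ⟨n, f, hf, φ, rfl⟩
  exact h n f hf φ

theorem subst_consequences {f : Poly F X} (hf : f ∈ consequences S X) (φ : X → Poly F Y) :
    Poly.subst φ f ∈ consequences S Y := by
  have h : consequences S X ≤ (consequences S Y).comap (Poly.subst φ) := by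
    refine consequences_le (fun o x y hy => ?_) fun n f hf ψ => ?_
    · simp only [Submodule.mem_comap, Poly.subst_mul] at hy ⊢
      exact isIdeal_idealSpan _ _ o _ _ hy
    · rw [Submodule.mem_comap, Poly.subst, Poly.eval_subst]
      exact subst_mem_consequences hf _
  exact h hf

theorem consequences_le_consequences (h : ∀ n, ∀ f ∈ S n, f ∈ consequences S' (Fin n)) :
    consequences S X ≤ consequences S' X :=
  consequences_le (isIdeal_idealSpan _ _) fun n f hf φ => subst_consequences (h n f hf) φ

theorem isIdentity_of_mem_consequences {A : Type*} [AddCommGroup A] [Module F A]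
    {op : BilinOps F A} (h : ∀ n, ∀ f ∈ S n, IsIdentity op f) {f : Poly F X}
    (hf : f ∈ consequences S X) : IsIdentity op f := by
  intro a
  have h_le : consequences S X ≤ LinearMap.ker (Poly.eval op a) := by
    refine consequences_le (fun o x y hy => ?_) fun n f hf φ => ?_
    · simp only [LinearMap.mem_ker, Poly.eval_mul] at hy ⊢
      simp [hy]
    · rw [LinearMap.mem_ker, Poly.eval_subst]
      exact h n f hf _
  exact h_le hf

end Consequences

/-! ### Linearizations -/

theorem linearize_mem_multilinear {n : ℕ} {X : Type*} (p : Fin n → X) (f : Poly F X) :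
    linearize p f ∈ multilinear F n := by
  rw [linearize, multilinear, Finsupp.mem_supported]
  intro m hm
  rw [Finset.mem_coe, Finsupp.mem_support_iff, Finsupp.filter_apply] at hm
  exact by_contra fun h => hm (if_neg h)

namespace Mon

variable {X Y : Type*}

theorem count_eq_count_leaves [BEq X] [LawfulBEq X] (m : Mon X) (x : X) :
    m.count x = m.leaves.count x := by
  classical
  induction m with
  | var y => simp [count, leaves, List.count_singleton]
  | mul o l r hl hr => simp [count, leaves, hl, hr]

instance {n : ℕ} : DecidablePred (IsMultilinear (X := Fin n)) := fun m =>
  decidable_of_iff (∀ i, m.leaves.count i = 1) (by simp [IsMultilinear, count_eq_count_leaves])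

/-- The terms that arise from a monomial when the variable `x` is replaced by the sum of the
monomials in `f x`. -/
def bindSum (f : X → List (Mon Y)) : Mon X → List (Mon Y)
  | var x => f x
  | mul o l r => (l.bindSum f).flatMap fun a => (r.bindSum f).map (mul o a)

theorem subst_single_eq_bindSum (f : X → List (Mon Y)) (m : Mon X) :
    Poly.subst (fun x => ((f x).map fun a => Finsupp.single a (1 : F)).sum) (Finsupp.single m 1) =
      ((m.bindSum f).map fun a => Finsupp.single a 1).sum := by
  rw [Poly.subst, Poly.eval_single]
  induction m with
  | var x => rfl
  | mul o l r hl hr =>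
    rw [eval, hl, hr, ← LinearMap.flip_apply, map_list_sum, bindSum, List.map_flatMap]
    simp only [List.flatMap_def, List.sum_flatten, List.map_map, Function.comp_def,
      LinearMap.flip_apply]
    simp only [map_list_sum, List.map_map, Function.comp_def, Poly.mul_single_single]

/-- Replace the variables in all possible ways by numbers `i < n` with the prescribed value
under `p`. -/
def spread {n : ℕ} [DecidableEq X] (p : Fin n → X) : Mon X → List (Mon (Fin n)) :=
  bindSum fun x => ((List.finRange n).filter fun i => p i = x).map var

end Mon

namespace Comb

variable {X : Type*}

theorem toPoly_filter (P : Mon X → Prop) [DecidablePred P] (l : Comb X) :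
    (toPoly F l).filter P = toPoly F (l.filter fun q => P q.2) := by
  induction l with
  | nil => exact Finsupp.filter_zero P
  | cons q l ih =>
    have hq : ((q.1 • Finsupp.single q.2 1 : Poly F X)).filter P =
      q.1 • (Finsupp.single q.2 1 : Poly F X).filter P :=
      map_zsmul (Finsupp.filterAddHom P) q.1 (Finsupp.single q.2 1)
    simp only [toPoly] at ih
    rw [toPoly, val_cons, Finsupp.filter_add, hq, ih]
    by_cases h : P q.2 <;> simp [h, toPoly]

/-- The linearization of a combination. -/
def linearize {n : ℕ} [DecidableEq X] (p : Fin n → X) (l : Comb X) : Comb (Fin n) :=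
  (l.flatMap fun q => (q.2.spread p).map fun m => (q.1, m)).filter fun q => q.2.IsMultilinear

theorem linearize_toPoly {n : ℕ} [DecidableEq X] (p : Fin n → X) (l : Comb X) :
    JJ.linearize p (toPoly F l) = toPoly F (l.linearize p) := by
  have sum_eq (x : X) : (∑ i with p i = x, Poly.var i : Poly F (Fin n)) =
      ((((List.finRange n).filter fun i => p i = x).map Mon.var).map
        fun a => Finsupp.single a 1).sum := by
    rw [List.map_map, ← List.sum_toFinset _ ((List.nodup_finRange n).filter _)]
    exact Finset.sum_congr (by ext; simp) fun _ _ => rfl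
  have subst_eq : Poly.subst (fun x => ∑ i with p i = x, Poly.var i) (toPoly F l) =
      toPoly F (l.flatMap fun q => (q.2.spread p).map fun m => (q.1, m)) := by
    simp only [sum_eq, toPoly, map_val, val_flatMap, Function.comp_def,
      Mon.subst_single_eq_bindSum]
    simp only [val, List.map_map, Function.comp_def, List.smul_sum, Mon.spread]
  rw [linearize, ← toPoly_filter, ← subst_eq, JJ.linearize]
  congr!

end Comb

end Polynomials

/-! ### Combinations for the identities -/

namespace Mon

variable {X : Type*}

/-- Numerals stand for variables. -/
scoped instance (n : ℕ) [OfNat X n] : OfNat (Mon X) n := ⟨var (OfNat.ofNat n)⟩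

/-- Product with the first operation. -/
def c (l r : Mon X) : Mon X := mul .circ l r

/-- Product with the second operation. -/
def b (l r : Mon X) : Mon X := mul .bullet l r

end Mon

section Linearized

open Mon

/-- The linearized Jordan identity. -/
def jordanLin (o : Op) : Comb (Fin 4) :=
  Comb.linearize (![0, 0, 0, 1] : Fin 4 → Fin 2)
    [(1, mul o 0 (mul o 1 (mul o 0 0))), (-1, mul o (mul o 0 1) (mul o 0 0))]

/-- The linearization of `newJJ4`. -/
def newLin4 : Comb (Fin 4) :=
  Comb.linearize (fun _ => (0 : Fin 1)) [(1, b (c 0 0) (c 0 0)), (-1, c (b 0 0) (b 0 0))]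

/-- The linearizations of `newJJ51` and `newJJ52`. -/
def newLin5 : Op → Comb (Fin 5)
  | .circ => Comb.linearize (![0, 0, 0, 0, 1] : Fin 5 → Fin 2)
    [(1, b (c 0 1) (c 0 (c 0 0))), (-1, c (b 0 0) (b 1 (c 0 0)))]
  | .bullet => Comb.linearize (![0, 0, 0, 0, 1] : Fin 5 → Fin 2)
    [(1, b (c 0 0) (c 1 (b 0 0))), (-1, c (b 0 1) (b 0 (b 0 0)))]

variable {F : Type*} [Field F]

theorem Comb.toPoly_pair_sub {X : Type*} (m n : Mon X) :
    Comb.toPoly F [(1, m), (-1, n)] = Finsupp.single m 1 - Finsupp.single n 1 := by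
  simp [toPoly, sub_eq_add_neg]

theorem linearize_jordanIdentity (o : Op) :
    linearize (![0, 0, 0, 1] : Fin 4 → Fin 2) (jordanIdentity F o) =
      (jordanLin o).toPoly F := by
  rw [jordanLin, ← Comb.linearize_toPoly]
  simp only [Comb.toPoly_pair_sub, jordanIdentity, Poly.var, Poly.mul_single_single]
  rfl

theorem linearize_newJJ4 :
    linearize (fun _ : Fin 4 => (0 : Fin 1)) (newJJ4 F) = newLin4.toPoly F := by
  rw [newLin4, ← Comb.linearize_toPoly]
  simp only [Comb.toPoly_pair_sub, newJJ4, Poly.var, Poly.mul_single_single]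
  rfl

variable (F) in
/-- The linearizations of `newJJ51` and `newJJ52`, indexed by the operation that occurs more
often in them. -/
noncomputable def linJJ5 : Op → Poly F (Fin 5)
  | .circ => linJJ51 F
  | .bullet => linJJ52 F

theorem linJJ5_eq (o : Op) : linJJ5 F o = (newLin5 o).toPoly F := by
  cases o
  all_goals
    simp only [linJJ5, linJJ51, linJJ52, newLin5, ← Comb.linearize_toPoly, Comb.toPoly_pair_sub,
      newJJ51, newJJ52, Poly.var, Poly.mul_single_single]
    rfl

end Linearized

/-! ### Identities of the Jordan products -/

/-- Associativity of two operations and the interchange identity. -/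
structure IsAssocInterchange {A : Type*} (op : Op → A → A → A) : Prop where
  assoc (o : Op) (x y z : A) : op o (op o x y) z = op o x (op o y z)
  interchange (x y z w : A) :
    op .bullet (op .circ x y) (op .circ z w) = op .circ (op .bullet x z) (op .bullet y w)

namespace Mon

variable {X A : Type*}

/-- The product for the associative operation `p`, bracketed to the right. -/
def append (p : Op) : Mon X → Mon X → Mon X
  | var x, r => mul p (var x) r
  | mul q a b, r => bif p == q then mul p a (append p b r) else mul p (mul q a b) r

/-- The product with the operation `p`, transformed by the interchange identity if `p = o`. -/
def appendInterchange (o p : Op) : Mon X → Mon X → Mon X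
  | mul q a b, mul q' c d =>
    bif o == p && (o.other == q && o.other == q') then
      append o.other (append o a c) (append o b d)
    else append p (mul q a b) (mul q' c d)
  | l, r => append p l r

/-- A monomial with the same values in associative interchange algebras. The interchange identity
is used in the direction in which products with the operation `o` move inside. -/
def normalForm (o : Op) : Mon X → Mon X
  | var x => var x
  | mul p l r => appendInterchange o p (l.normalForm o) (r.normalForm o)

variable {op : Op → A → A → A}

theorem eval_append (hop : IsAssocInterchange op) (a : X → A) (p : Op) (l r : Mon X) :
    (append p l r).eval op a = op p (l.eval op a) (r.eval op a) := by
  induction l with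
  | var x => rfl
  | mul q b c _ hc =>
    rw [append]
    cases h : p == q
    · rfl
    · obtain rfl := eq_of_beq h
      simp only [cond_true, eval, hc, hop.assoc]

theorem eval_appendInterchange (hop : IsAssocInterchange op) (a : X → A) (o p : Op)
    (l r : Mon X) : (appendInterchange o p l r).eval op a = op p (l.eval op a) (r.eval op a) := by
  rcases l with x | ⟨q, b, c⟩ <;> rcases r with y | ⟨q', d, e⟩ <;>
    simp only [appendInterchange, eval_append hop]
  cases h : o == p && (o.other == q && o.other == q')
  · exact eval_append hop ..
  · simp only [Bool.and_eq_true, beq_iff_eq] at h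
    obtain ⟨rfl, rfl, rfl⟩ := h
    simp only [cond_true, eval_append hop, eval]
    cases o
    · exact hop.interchange ..
    · exact (hop.interchange ..).symm

theorem eval_normalForm (hop : IsAssocInterchange op) (a : X → A) (o : Op) (m : Mon X) :
    (m.normalForm o).eval op a = m.eval op a := by
  induction m with
  | var x => rfl
  | mul p l r hl hr => rw [normalForm, eval_appendInterchange hop, hl, hr, eval]

end Mon

section Verification

variable {F A X Y : Type*} [Field F] [AddCommGroup A] [Module F A] {op : BilinOps F A}

theorem eval_jordan (op : BilinOps F A) (a : X → A) (m : Mon X) :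
    m.eval (fun o x y => jordan op o x y) a =
      (m.expand.map (Mon.eval (fun o x y => op o x y) a)).sum := by
  induction m with
  | var x => simp [Mon.eval, Mon.expand]
  | mul o l r hl hr =>
    rw [Mon.eval, hl, hr, Mon.expand, ← LinearMap.flip_apply, map_list_sum, List.map_flatMap]
    simp only [List.flatMap_def, List.sum_flatten, List.map_map, Function.comp_def,
      LinearMap.flip_apply]
    simp [map_list_sum, List.map_map, Function.comp_def, jordan, Mon.eval]

/-- The expansion of a combination of monomials in the Jordan products. -/
def Comb.expand (l : Comb X) : Comb X := l.flatMap fun p => p.2.expand.map fun m => (p.1, m)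

theorem Comb.val_expand {V : Type*} [AddCommGroup V] (v : Mon X → V) (l : Comb X) :
    val v l.expand = val (fun m => (m.expand.map v).sum) l := by
  rw [expand, val_flatMap]
  simp only [val, List.map_map, Function.comp_def, List.smul_sum]

theorem isIdentity_of_rename {g : X → Y} (hg : g.Injective) {f : Poly F X}
    (h : IsIdentity op (Poly.rename g f)) : IsIdentity op f := fun a => by
  rw [← Function.extend_comp hg a 0, ← Poly.eval_rename, h]

/-- The combination with the variables numbered by natural numbers. -/
def Comb.toNat {n : ℕ} (l : Comb (Fin n)) : Comb ℕ := l.mapMon (Mon.map Fin.val)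

theorem isIdentity_jordan_of_isZero (hop : IsAssocInterchange fun o x y => op o x y) {n : ℕ}
    (o : Op) (l : Comb (Fin n)) (h : (l.toNat.expand.mapMon (Mon.normalForm o)).isZero = true) :
    IsIdentity (jordan op) (l.toPoly F) := by
  refine isIdentity_of_rename Fin.val_injective fun a => ?_
  have h_val := Comb.val_eq_zero (Mon.eval (fun o x y => op o x y) a) h
  simp only [Comb.val_mapMon, Function.comp_def, Mon.eval_normalForm hop, Comb.val_expand,
    ← eval_jordan] at h_val
  rw [Comb.rename_toPoly, Comb.eval_toPoly]
  exact h_val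

namespace FreeAI

theorem op_mk (o : Op) (x y : Poly F X) :
    FreeAI.op F X o ((interchangeIdeal F X).mkQ x) ((interchangeIdeal F X).mkQ y) =
      (interchangeIdeal F X).mkQ (Poly.mul F X o x y) := rfl

theorem mkQ_subst_eq_zero {n : ℕ} {f : Poly F (Fin n)} (hf : AssocInterchange F n f)
    (φ : Fin n → Poly F X) : (interchangeIdeal F X).mkQ (Poly.subst φ f) = 0 :=
  (Submodule.Quotient.mk_eq_zero _).2 <|
    subst_mem_consequences (S := fun n => {f | AssocInterchange F n f}) hf φ

variable (F X) in
theorem isAssocInterchange_op : IsAssocInterchange fun o x y => FreeAI.op F X o x y where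
  assoc o x y z := by
    obtain ⟨x, rfl⟩ := Submodule.mkQ_surjective _ x
    obtain ⟨y, rfl⟩ := Submodule.mkQ_surjective _ y
    obtain ⟨z, rfl⟩ := Submodule.mkQ_surjective _ z
    have h := mkQ_subst_eq_zero (.assoc o) ![x, y, z]
    simp only [map_sub, Poly.subst_mul, Poly.subst_var] at h
    exact sub_eq_zero.1 h
  interchange x y z w := by
    obtain ⟨x, rfl⟩ := Submodule.mkQ_surjective _ x
    obtain ⟨y, rfl⟩ := Submodule.mkQ_surjective _ y
    obtain ⟨z, rfl⟩ := Submodule.mkQ_surjective _ z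
    obtain ⟨w, rfl⟩ := Submodule.mkQ_surjective _ w
    have h := mkQ_subst_eq_zero .interchange ![x, y, z, w]
    simp only [map_sub, Poly.subst_mul, Poly.subst_var] at h
    exact sub_eq_zero.1 h

end FreeAI

theorem commutativity_mem_multilinear (o : Op) : commutativity F o ∈ multilinear F 2 := by
  have h (i j : Fin 2) (hij : (Mon.mul o (.var i) (.var j)).IsMultilinear) :
      Poly.mul F (Fin 2) o (Poly.var i) (Poly.var j) ∈ multilinear F 2 := by
    rw [Poly.var, Poly.var, Poly.mul_single_single]
    exact Finsupp.single_mem_supported _ _ hij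
  exact sub_mem (h 0 1 (by cases o <;> decide)) (h 1 0 (by cases o <;> decide))

theorem lowerList_mem_allIdentities {n : ℕ} {f : Poly F (Fin n)} (h : LowerList F n f) :
    f ∈ allIdentities F n := by
  cases h with
  | comm o =>
    refine ⟨commutativity_mem_multilinear o, fun a => ?_⟩
    simp [commutativity, Poly.eval_mul, Poly.eval_var, jordan, add_comm]
  | jordan o =>
    refine ⟨linearize_mem_multilinear _ _, ?_⟩
    rw [linearize_jordanIdentity]
    refine isIdentity_jordan_of_isZero (FreeAI.isAssocInterchange_op F ℕ) o _ ?_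
    cases o <;> decide +kernel
  | new4 =>
    refine ⟨linearize_mem_multilinear _ _, ?_⟩
    rw [linearize_newJJ4]
    exact isIdentity_jordan_of_isZero (FreeAI.isAssocInterchange_op F ℕ) .circ _ (by decide +kernel)

theorem linJJ5_mem_allIdentities (o : Op) : linJJ5 F o ∈ allIdentities F 5 := by
  constructor
  · cases o <;> exact linearize_mem_multilinear _ _
  · rw [linJJ5_eq]
    refine isIdentity_jordan_of_isZero (FreeAI.isAssocInterchange_op F ℕ) o _ ?_
    cases o <;> decide +kernel

end Verification

/-! ### A left inverse of the expansion of Jordan monomials -/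

/-- The factors of a monomial for the associative operation `o`. -/
def Mon.factors {X : Type*} (o : Op) : Mon X → List (Mon X)
  | var x => [var x]
  | mul p l r => bif o == p then l.factors o ++ r.factors o else [mul p l r]

/-- Substitution of the given monomials for the variables, with the two operations exchanged if `o`
is `bullet`. -/
def Comb.inst (l : Comb ℕ) : Op → List (Mon ℕ) → Comb ℕ
  | .circ, v => l.mapMon (Mon.bind fun i => v.getD i (.var 0))
  | .bullet, v => l.mapMon fun m => m.swap.bind fun i => v.getD i (.var 0)

namespace Symmetrize

open Mon

/-- Symmetrization of a product of three factors. -/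
def triple (o : Op) (x y z : Comb ℕ) : Comb ℕ :=
  Comb.mul o x (Comb.mul o y z) ++ (Comb.mul o z (Comb.mul o x y) ++
    (Comb.mul o y (Comb.mul o x z)).scale (-1))

/-- Symmetrization of a product of four factors. The coefficients here and in `square`,
`quintuple` and `rectangle` are a solution of the linear system that is checked by `invarianceTest`
and `inverseTest`. -/
def quadruple : Comb ℕ :=
  [(4, c (c 0 1) (c 2 3)), (-4, c (c 0 3) (c 1 2)), (-8, c 1 (c 3 (c 0 2))),
   (18, c 0 (c 1 (c 2 3))), (10, c 1 (c 2 (c 0 3))), (2, c 0 (c 2 (c 1 3))),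
   (-16, c 2 (c 3 (c 0 1)))]

/-- Symmetrization of `(0 ∘ 1) • (2 ∘ 3)`. -/
def square : Comb ℕ :=
  [(5, b (c 0 1) (c 2 3)), (1, b (c 0 2) (c 1 3)), (-3, b (c 0 3) (c 1 2)),
   (5, c (b 0 2) (b 1 3)), (1, c (b 0 1) (b 2 3)), (-3, c (b 0 3) (b 1 2))]

/-- Symmetrization of a product of five factors. -/
def quintuple : Comb ℕ :=
  [(20, c 0 (c 4 (c 1 (c 2 3)))), (60, c 1 (c 4 (c 2 (c 0 3)))), (-140, c (c 1 2) (c 0 (c 3 4))),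
   (120, c 0 (c 1 (c 2 (c 3 4)))), (-20, c 1 (c 0 (c 2 (c 3 4)))), (-140, c 1 (c 4 (c 0 (c 2 3)))),
   (-40, c 0 (c 1 (c 3 (c 2 4)))), (40, c 4 (c 2 (c 1 (c 0 3)))), (20, c 3 (c 2 (c 1 (c 0 4)))),
   (80, c 0 (c 3 (c 1 (c 2 4)))), (30, c 2 (c 1 (c 3 (c 0 4)))), (20, c 2 (c (c 0 3) (c 1 4))),
   (30, c 2 (c 4 (c 3 (c 0 1)))), (60, c 3 (c 1 (c 2 (c 0 4)))), (-40, c 3 (c 0 (c 1 (c 2 4)))),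
   (40, c 4 (c (c 0 1) (c 2 3))), (-50, c 2 (c 4 (c 1 (c 0 3)))), (-100, c (c 2 4) (c 0 (c 1 3))),
   (40, c (c 0 1) (c 4 (c 2 3)))]

/-- Symmetrization of `(0 ∘ 1) • (2 ∘ 3 ∘ 4)`. -/
def rectangle : Comb ℕ :=
  [(8, b (c 0 4) (c 3 (c 1 2))), (-30, b (c 0 1) (c 3 (c 2 4))), (76, b (c 0 1) (c 4 (c 2 3))),
   (32, b (c 0 2) (c 1 (c 3 4))), (-8, b (c 3 4) (c 1 (c 0 2))), (-16, c (b 0 1) (b 2 (c 3 4))),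
   (8, b (c 2 3) (c 1 (c 0 4))), (16, c (b 1 3) (b 4 (c 0 2))), (16, c (b 0 2) (b 1 (c 3 4))),
   (-48, c (b 0 4) (b 1 (c 2 3))), (-8, b (c 0 2) (c 3 (c 1 4))), (-16, c (b 1 3) (b 2 (c 0 4)))]

/-- Symmetrization in degrees at most three. -/
def upToThree : Mon ℕ → Comb ℕ
  | var x => .of (var x)
  | mul o l r => match factors o (mul o l r) with
    | [x, y, z] => triple o (.of x) (.of y) (.of z)
    | _ => .of (mul o l r)

/-- Symmetrization of a product of two products of two variables. -/
def squareOf (o : Op) : Mon ℕ → Mon ℕ → Comb ℕ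
  | mul _ x y, mul _ z w => square.inst o.other [x, y, z, w]
  | x, y => (Comb.mul o (upToThree x) (upToThree y)).scale 6

/-- Symmetrization in degree four. -/
def four : Mon ℕ → Comb ℕ
  | var _ => []
  | mul o l r => match factors o (mul o l r) with
    | [x, y, z, w] => quadruple.inst o [x, y, z, w]
    | [x, y, z] => (triple o (.of x) (.of y) (.of z)).scale 6
    | [x, y] => bif x.size == 2 then squareOf o x y
        else (Comb.mul o (upToThree x) (upToThree y)).scale 6
    | _ => []

/-- Symmetrization of the product of a variable `x` and two adjacent products `y`, `z` of two
variables; `k` is `1` or `-1` according to the side on which `x` stands. -/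
def adjacent (o : Op) (k : ℤ) (x y z : Mon ℕ) : Comb ℕ :=
  (Comb.mul o (.of x) (squareOf o y z)).scale 5 ++
    [(30 * k, mul o z (mul o x y)), (-30 * k, mul o y (mul o x z))]

/-- The columns of a product of two products of two variables. -/
def columns (o : Op) : Mon ℕ → Option (Mon ℕ × Mon ℕ)
  | mul p (mul q x y) (mul q' z w) =>
    bif (x.size + y.size + z.size + w.size) == 4 && (o == q && o == q') then
      some (mul p x z, mul p y w) else none
  | _ => none

/-- Symmetrization of the product with the operation `o` of `x` and `y`, one of which is a
variable. -/
def withVariable (o : Op) (k : ℤ) (x y : Mon ℕ) : Comb ℕ :=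
  match columns o y with
  | some (z, w) => adjacent o k x z w
  | none => (Comb.mul o (.of x) (four y)).scale 5

/-- Symmetrization of the product of two rows with two and three entries. -/
def rows (o : Op) (x y : List (Mon ℕ)) : Comb ℕ :=
  bif x.length == 2 then rectangle.inst o.other (x ++ y)
  else rectangle.inst o.other (y ++ x)

/-- Symmetrization of the product of a product of two variables and one of three variables. -/
def pair (o : Op) (x y : List (Mon ℕ)) : Comb ℕ :=
  match x, y with
  | [x₁, x₂], [y₁, y₂] =>
    rows o.other (factors o x₁ ++ factors o y₁) (factors o x₂ ++ factors o y₂)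
  | _, _ => rows o x y

/-- Symmetrization in degree five. -/
def five : Mon ℕ → Comb ℕ
  | var _ => []
  | mul o l r => match factors o (mul o l r) with
    | [x, y, z, v, w] => quintuple.inst o [x, y, z, v, w]
    | [x, y, z, w] => (quadruple.inst o [x, y, z, w]).scale 5
    | [x, y, z] =>
      bif x.size == 1 && (y.size == 2 && z.size == 2) then adjacent o 1 x y z
      else bif z.size == 1 && (x.size == 2 && y.size == 2) then
        adjacent o (-1) z x y
      else (triple o (upToThree x) (upToThree y) (upToThree z)).scale 30
    | [x, y] =>
      bif x.size == 1 then withVariable o 1 x y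
      else bif y.size == 1 then withVariable o (-1) y x
      else pair o (factors o.other x) (factors o.other y)
    | _ => []

/-- Symmetrization of monomials of degree `n` whose leaves are numbered. -/
def ofDegree : ℕ → Mon ℕ → Comb ℕ
  | 5 => five
  | 4 => four
  | _ => upToThree

/-- The factor by which symmetrization after expansion multiplies a monomial of degree `n`. -/
def factor : ℕ → ℤ
  | 5 => 480
  | 4 => 48
  | 3 => 4
  | 2 => 2
  | _ => 1

end Symmetrize

/-- The value at a monomial `m` of degree `n` in two associative operations of a left inverse, up to
the factor `Symmetrize.factor n` and known identities, of the expansion of Jordan monomials. -/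
def symmetrize {X : Type*} (n : ℕ) (m : Mon X) : Comb X :=
  (Symmetrize.ofDegree n (m.relabel 0)).mapMon (Mon.map m.leaf)

/-! ### Certificates -/

section Certificates

open Mon

/-- Half of the linearized Jordan identity, up to commutativity. -/
def jordanTerms (o : Op) (x y z w : Mon ℕ) : Comb ℕ :=
  [(1, mul o x (mul o w (mul o y z))), (1, mul o y (mul o w (mul o x z))),
   (1, mul o z (mul o w (mul o x y))), (-1, mul o (mul o x w) (mul o y z)),
   (-1, mul o (mul o y w) (mul o x z)), (-1, mul o (mul o z w) (mul o x y))]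

/-- One eighth of the linearization of `newJJ4`, up to commutativity. -/
def newTerms4 (x y z w : Mon ℕ) : Comb ℕ :=
  [(1, b (c x y) (c z w)), (1, b (c x z) (c y w)), (1, b (c x w) (c y z)),
   (-1, c (b x y) (b z w)), (-1, c (b x z) (b y w)), (-1, c (b x w) (b y z))]

/-- The orders of `0, 1, 2, 3` in which the last two numbers are increasing. -/
def arrangements : List (Mon ℕ × Mon ℕ × Mon ℕ × Mon ℕ) :=
  [(0, 1, 2, 3), (0, 2, 1, 3), (0, 3, 1, 2), (1, 0, 2, 3), (1, 2, 0, 3), (1, 3, 0, 2),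
   (2, 0, 1, 3), (2, 1, 0, 3), (2, 3, 0, 1), (3, 0, 1, 2), (3, 1, 0, 2), (3, 2, 0, 1)]

/-- Half of the linearization of `newJJ51` or `newJJ52`, up to commutativity. -/
def newTerms5 : Op → Comb ℕ
  | .circ => arrangements.flatMap fun (x, y, z, w) =>
    [(1, b (c x 4) (c y (c z w))), (-1, c (b x y) (b 4 (c z w)))]
  | .bullet => arrangements.flatMap fun (x, y, z, w) =>
    [(1, b (c x y) (c 4 (b z w))), (-1, c (b x 4) (b y (b z w)))]

/-- Multilinear consequences of the Jordan identities and of `newJJ4`. -/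
inductive Rel
  | jordan (o : Op) (x y z w : Mon ℕ)
  | interchange (x y z w : Mon ℕ)
  | under (o : Op) (x : Mon ℕ) (r : Rel)

namespace Rel

/-- The combination that a relation stands for. -/
def comb : Rel → Comb ℕ
  | jordan o x y z w => jordanTerms o x y z w
  | interchange x y z w => newTerms4 x y z w
  | under o x r => Comb.mul o (.of x) r.comb

/-- Exchange of the two operations; the combination of `interchange` changes its sign. -/
def swap : ℤ × Rel → ℤ × Rel
  | (k, jordan o x y z w) => (k, jordan o.other x.swap y.swap z.swap w.swap)
  | (k, interchange x y z w) => (-k, interchange x.swap y.swap z.swap w.swap)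
  | (k, under o x r) => ((swap (k, r)).1, under o.other x.swap (swap (k, r)).2)

end Rel

/-- Half of the linearization of `newJJ51` or `newJJ52` with the distinguished variable `i`. -/
def hook (o : Op) (i : Fin 5) : Comb ℕ := (newTerms5 o).mapMon (Mon.map (Equiv.swap (i : ℕ) 4))

/-- For some oriented monomials with root `circ`, the relations that turn symmetrization after
expansion into a multiple of the identity; their coefficients were found by linear algebra. -/
def relTable : List (Mon ℕ × List (ℤ × Rel)) :=
  [(c 0 (c 1 (c 2 3)),
    [(-22, .jordan .circ 0 1 3 2), (12, .jordan .circ 0 2 3 1),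
      (-22, .jordan .circ 0 1 2 3), (32, .jordan .circ 1 2 3 0)]),
   (c (c 0 1) (c 2 3),
    [(-4, .jordan .circ 0 1 3 2), (-4, .jordan .circ 0 2 3 1),
      (-4, .jordan .circ 0 1 2 3), (-4, .jordan .circ 1 2 3 0)]),
   (c (b 0 1) (b 2 3),
    [(-8, .interchange 0 1 2 3)]),
   (c 0 (c 1 (c 2 (c 3 4))),
    [(-200, .under .circ 1 (.jordan .circ 0 2 3 4)), (140, .jordan .circ (c 2 3) 0 4 1),
      (90, .under .circ 4 (.jordan .circ 0 1 2 3)), (-110, .under .circ 2 (.jordan .circ 0 1 4 3)),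
      (-280, .jordan .circ (c 0 2) 3 4 1), (90, .under .circ 3 (.jordan .circ 0 1 2 4)),
      (140, .jordan .circ (c 1 4) 2 3 0), (-200, .jordan .circ (c 0 1) 2 4 3),
      (140, .jordan .circ (c 3 4) 0 1 2), (200, .jordan .circ (c 2 3) 1 4 0),
      (200, .jordan .circ (c 2 4) 1 3 0), (-240, .jordan .circ 0 2 3 (c 1 4)),
      (-180, .under .circ 0 (.jordan .circ 2 3 4 1)), (-10, .under .circ 4 (.jordan .circ 0 2 3 1)),
      (-500, .jordan .circ 0 1 4 (c 2 3)), (20, .under .circ 2 (.jordan .circ 0 3 4 1)),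
      (-200, .under .circ 0 (.jordan .circ 1 2 3 4)), (-80, .under .circ 0 (.jordan .circ 1 3 4 2)),
      (280, .jordan .circ 1 3 4 (c 0 2)), (140, .under .circ 1 (.jordan .circ 2 3 4 0)),
      (-200, .under .circ 1 (.jordan .circ 0 2 4 3)),
      (-110, .under .circ 2 (.jordan .circ 0 1 3 4)),
      (540, .jordan .circ 2 3 4 (c 0 1)), (-10, .under .circ 3 (.jordan .circ 0 2 4 1)),
      (-280, .jordan .circ (c 0 1) 3 4 2), (-240, .jordan .circ 0 2 4 (c 1 3)),
      (140, .jordan .circ (c 1 3) 2 4 0), (-200, .jordan .circ (c 0 1) 2 3 4),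
      (200, .jordan .circ (c 3 4) 1 2 0), (-200, .under .circ 0 (.jordan .circ 1 2 4 3)),
      (140, .jordan .circ (c 2 4) 0 3 1), (-820, .jordan .circ 0 1 2 (c 3 4)),
      (-500, .jordan .circ 0 1 3 (c 2 4)), (280, .jordan .circ (c 3 4) 0 2 1),
      (-200, .under .circ 1 (.jordan .circ 0 3 4 2))]),
   (c 0 (c 1 (c 2 (b 3 4))),
    [(120, .jordan .circ (b 3 4) 0 2 1), (320, .jordan .circ (b 3 4) 1 2 0),
      (-220, .jordan .circ (b 3 4) 0 1 2), (-220, .jordan .circ 0 1 2 (b 3 4))]),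
   (c 0 (b 1 (b 2 (b 3 4))),
    [(-220, .under .circ 0 (.jordan .bullet 1 2 4 3)),
    (120, .under .circ 0 (.jordan .bullet 1 3 4 2)),
      (-220, .under .circ 0 (.jordan .bullet 1 2 3 4)),
      (320, .under .circ 0 (.jordan .bullet 2 3 4 1))]),
   (c 0 (c (c 1 2) (c 3 4)),
    [(240, .under .circ 2 (.jordan .circ 1 3 4 0)), (140, .jordan .circ (c 1 3) 0 4 2),
      (140, .jordan .circ (c 1 4) 2 3 0), (-560, .jordan .circ 0 1 2 (c 3 4)),
      (140, .jordan .circ (c 1 4) 0 3 2), (-240, .under .circ 0 (.jordan .circ 1 2 4 3)),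
      (220, .under .circ 3 (.jordan .circ 0 1 2 4)), (-110, .under .circ 1 (.jordan .circ 0 2 3 4)),
      (-110, .under .circ 2 (.jordan .circ 0 1 4 3)), (-480, .jordan .circ 0 1 3 (c 2 4)),
      (-240, .jordan .circ (c 3 4) 0 2 1), (140, .jordan .circ (c 2 3) 1 4 0),
      (-110, .under .circ 4 (.jordan .circ 0 2 3 1)), (220, .under .circ 4 (.jordan .circ 0 1 2 3)),
      (-240, .under .circ 0 (.jordan .circ 2 3 4 1)),
      (-180, .under .circ 1 (.jordan .circ 0 3 4 2)),
      (-110, .under .circ 1 (.jordan .circ 0 2 4 3)), (-240, .jordan .circ 0 2 3 (c 1 4)),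
      (-180, .under .circ 2 (.jordan .circ 0 3 4 1)),
      (-110, .under .circ 3 (.jordan .circ 0 2 4 1)),
      (140, .jordan .circ (c 1 3) 2 4 0), (-110, .under .circ 2 (.jordan .circ 0 1 3 4)),
      (140, .jordan .circ (c 2 4) 1 3 0), (400, .jordan .circ (c 3 4) 1 2 0),
      (140, .jordan .circ (c 2 4) 0 1 3), (160, .jordan .circ 1 3 4 (c 0 2)),
      (140, .jordan .circ (c 2 3) 0 4 1), (400, .jordan .circ 2 3 4 (c 0 1)),
      (-240, .jordan .circ 0 2 4 (c 1 3)), (140, .jordan .circ (c 2 3) 0 1 4),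
      (-480, .jordan .circ 0 1 4 (c 2 3)), (-100, .jordan .circ (c 1 3) 0 2 4),
      (-400, .jordan .circ (c 0 1) 3 4 2), (140, .jordan .circ (c 2 4) 0 3 1),
      (-100, .jordan .circ (c 1 4) 0 2 3), (-110, .under .circ 3 (.jordan .circ 0 1 4 2)),
      (-400, .jordan .circ (c 0 2) 3 4 1), (-240, .under .circ 0 (.jordan .circ 1 2 3 4)),
      (-110, .under .circ 4 (.jordan .circ 0 1 3 2))]),
   (c 0 (b (c 1 2) (c 3 4)),
    [(80, .under .circ 0 (.interchange 1 2 3 4))]),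
   (c 0 (c (c 1 2) (b 3 4)),
    [(-220, .jordan .circ (b 3 4) 0 2 1), (320, .jordan .circ (b 3 4) 1 2 0),
      (-220, .jordan .circ (b 3 4) 0 1 2), (120, .jordan .circ 0 1 2 (b 3 4))]),
   (c 0 (c (b 1 2) (b 3 4)),
    [(-80, .under .circ 0 (.interchange 1 2 3 4))]),
   (c 0 (b (b 1 2) (b 3 4)),
    [(-40, .under .circ 0 (.jordan .bullet 1 2 4 3)),
    (-40, .under .circ 0 (.jordan .bullet 1 3 4 2)),
      (-40, .under .circ 0 (.jordan .bullet 1 2 3 4)),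
      (-40, .under .circ 0 (.jordan .bullet 2 3 4 1))]),
   (c (c 0 1) (c 2 (c 3 4)),
    [(20, .under .circ 2 (.jordan .circ 1 3 4 0)), (60, .jordan .circ (c 2 3) 1 4 0),
      (-80, .jordan .circ (c 3 4) 1 2 0), (-80, .under .circ 1 (.jordan .circ 0 2 3 4)),
      (-120, .under .circ 0 (.jordan .circ 1 3 4 2)), (-10, .under .circ 4 (.jordan .circ 0 2 3 1)),
      (280, .jordan .circ (c 3 4) 0 1 2), (-100, .jordan .circ (c 0 3) 2 4 1),
      (-120, .under .circ 1 (.jordan .circ 0 3 4 2)), (-40, .under .circ 0 (.jordan .circ 2 3 4 1)),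
      (-40, .jordan .circ 0 1 4 (c 2 3)), (220, .jordan .circ (c 1 4) 2 3 0),
      (-80, .under .circ 0 (.jordan .circ 1 2 3 4)), (20, .under .circ 2 (.jordan .circ 0 3 4 1)),
      (-60, .under .circ 3 (.jordan .circ 0 1 2 4)), (-80, .jordan .circ (c 3 4) 0 2 1),
      (-320, .jordan .circ (c 0 1) 2 4 3), (-60, .under .circ 4 (.jordan .circ 0 1 2 3)),
      (-200, .under .circ 3 (.jordan .circ 0 1 4 2)), (120, .under .circ 4 (.jordan .circ 0 1 3 2)),
      (20, .under .circ 2 (.jordan .circ 0 1 3 4)), (60, .jordan .circ (c 2 3) 0 4 1),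
      (220, .jordan .circ (c 0 4) 2 3 1), (60, .jordan .circ (c 2 4) 1 3 0),
      (60, .jordan .circ (c 2 4) 0 3 1), (-100, .jordan .circ (c 1 3) 2 4 0),
      (-360, .jordan .circ 0 1 3 (c 2 4)), (-400, .jordan .circ 0 1 2 (c 3 4)),
      (-10, .under .circ 4 (.jordan .circ 1 2 3 0)), (-80, .under .circ 0 (.jordan .circ 1 2 4 3)),
      (-320, .jordan .circ 0 2 3 (c 1 4)), (-40, .under .circ 1 (.jordan .circ 2 3 4 0)),
      (-10, .under .circ 3 (.jordan .circ 1 2 4 0)), (-10, .under .circ 3 (.jordan .circ 0 2 4 1)),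
      (40, .jordan .circ (c 0 1) 3 4 2), (-80, .under .circ 1 (.jordan .circ 0 2 4 3)),
      (-320, .jordan .circ 1 2 3 (c 0 4)), (-300, .under .circ 2 (.jordan .circ 0 1 4 3))]),
   (c (c 0 1) (c 2 (b 3 4)),
    [(-40, .jordan .circ (b 3 4) 0 2 1), (-40, .jordan .circ (b 3 4) 1 2 0),
      (-40, .jordan .circ (b 3 4) 0 1 2), (-40, .jordan .circ 0 1 2 (b 3 4))]),
   (c (b 0 1) (c 2 (c 3 4)),
    [(-220, .jordan .circ (b 0 1) 2 4 3), (120, .jordan .circ (b 0 1) 3 4 2),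
      (-220, .jordan .circ (b 0 1) 2 3 4), (320, .jordan .circ 2 3 4 (b 0 1))]),
   (c (b 0 1) (b 2 (c 3 4)),
    [(32, .interchange (c 2 4) 0 1 3), (-256, .interchange (c 3 4) 0 1 2),
      (96, .interchange (c 0 1) 2 3 4), (32, .interchange (c 2 3) 0 1 4)]),
   (c (b 0 1) (c 2 (b 3 4)),
    [(-40, .under .circ 2 (.interchange 0 1 3 4))]),
   (c (b 0 1) (b 2 (b 3 4)),
    [(64, .interchange (b 2 3) 0 1 4), (64, .interchange (b 2 4) 0 1 3),
      (128, .interchange (b 3 4) 0 1 2)]),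
   (c 0 (c (b 1 2) (c 3 4)),
    [(-220, .jordan .circ (b 1 2) 0 4 3), (320, .jordan .circ (b 1 2) 3 4 0),
      (-220, .jordan .circ (b 1 2) 0 3 4), (120, .jordan .circ 0 3 4 (b 1 2))])]

/-- The analogue of `relTable` for the relations `hook`. -/
def hookTable : List (Mon ℕ × List (ℤ × Fin 5)) :=
  [(c (b 0 1) (b 2 (c 3 4)), [(-48, 2), (-16, 4), (-16, 3)])]

/-- The relations of lower degree for a given monomial. -/
def relsOf : Mon ℕ → List (ℤ × Rel)
  | mul .bullet l r => ((relTable.lookup (mul .bullet l r).swap).getD []).map Rel.swap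
  | m => (relTable.lookup m).getD []

/-- The new relations of degree five for a given monomial. -/
def hooksOf : Mon ℕ → List (ℤ × Op × Fin 5)
  | mul .bullet l r =>
    ((hookTable.lookup (mul .bullet l r).swap).getD []).map fun p => (-p.1, .bullet, p.2)
  | m => ((hookTable.lookup m).getD []).map fun p => (p.1, .circ, p.2)

/-- The combination of all relations for a given monomial. -/
def certificate (m : Mon ℕ) : Comb ℕ :=
  ((relsOf m).flatMap fun p => p.2.comb.scale p.1) ++
    (hooksOf m).flatMap fun p => (hook p.2.1 p.2.2).scale p.1

/-- Decides whether symmetrization in degree `n` is compatible with associativity and the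
interchange identity. -/
def invarianceTest (n : ℕ) : Bool :=
  (Mon.shapes n n 0).all fun s => s.steps.all fun t =>
    Comb.isZeroComm (symmetrize n s ++ (symmetrize n t).scale (-1))

/-- Decides whether symmetrization after expansion in degree `n` is a multiple of the identity
modulo the relations of `certificate`. Up to commutativity it is enough to look at oriented
monomials. -/
def inverseTest (n : ℕ) : Bool :=
  (Mon.shapes n n 0).all fun s => !(s == s.orient) ||
    Comb.isZeroComm ((s.expand.flatMap (symmetrize n)) ++
      ((-Symmetrize.factor n, s) :: certificate s))

end Certificates

section Symmetrization

variable {F : Type*} [Field F] {X Y : Type*}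

/-! ### Consequences of the identities of degree at most four -/

variable (F X) in
/-- The consequences of commutativity, the Jordan identities and `newJJ4`. -/
noncomputable abbrev lowerConsequences : Submodule F (Poly F X) :=
  consequences (fun n => {g | LowerList F n g}) X

theorem lowerList_mem_lowerConsequences {n : ℕ} {f : Poly F (Fin n)} (h : LowerList F n f) :
    f ∈ lowerConsequences F (Fin n) :=
  mem_consequences (S := fun n => {g | LowerList F n g}) h

theorem isIdeal_lowerConsequences : IsIdeal (Poly.mul F X) (lowerConsequences F X) :=
  isIdeal_idealSpan _ _

theorem mul_sub_mul_comm_mem_lowerConsequences (o : Op) (p q : Poly F X) :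
    Poly.mul F X o p q - Poly.mul F X o q p ∈ lowerConsequences F X := by
  have h := subst_mem_consequences (S := fun n => {g | LowerList F n g}) (LowerList.comm o) ![p, q]
  simp only [commutativity, map_sub, Poly.subst_mul, Poly.subst_var] at h
  exact h

theorem IsIdeal.mul_sub_mul_mem {I : Submodule F (Poly F X)} (hI : IsIdeal (Poly.mul F X) I)
    (o : Op) {p p' q q' : Poly F X} (hp : p - p' ∈ I) (hq : q - q' ∈ I) :
    Poly.mul F X o p q - Poly.mul F X o p' q' ∈ I := by
  have h := add_mem (hI o q _ hp).2 (hI o p' _ hq).1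
  rwa [map_sub, LinearMap.sub_apply, map_sub, sub_add_sub_cancel] at h

theorem single_sub_single_mem_lowerConsequences {m n : Mon X} (h : Mon.CommEq m n) :
    Finsupp.single m 1 - Finsupp.single n 1 ∈ lowerConsequences F X := by
  induction h with
  | refl m => simp
  | mul o _ _ hl hr =>
    rw [← Poly.mul_single_single, ← Poly.mul_single_single]
    exact isIdeal_lowerConsequences.mul_sub_mul_mem o hl hr
  | @comm o l r _ _ _ _ hl hr =>
    rw [← Poly.mul_single_single, ← Poly.mul_single_single]
    have h := add_mem
      (mul_sub_mul_comm_mem_lowerConsequences o (Finsupp.single l 1) (Finsupp.single r 1))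
      (isIdeal_lowerConsequences.mul_sub_mul_mem o hr hl)
    rwa [sub_add_sub_cancel] at h

theorem toPoly_mem_of_isZeroComm (g : ℕ → X) {l : Comb ℕ} (h : l.isZeroComm = true) :
    (l.mapMon (Mon.map g)).toPoly F ∈ lowerConsequences F X := by
  have h_val := Comb.val_eq_zero_of_comm
    (v := fun m => (lowerConsequences F X).mkQ (Finsupp.single (m.map g) 1)) (fun m n hmn =>
      (Submodule.Quotient.eq _).2 (single_sub_single_mem_lowerConsequences (hmn.map g))) h
  rw [← Submodule.Quotient.mk_eq_zero, ← Submodule.mkQ_apply, Comb.toPoly, Comb.val_mapMon,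
    Comb.map_val]
  exact h_val

theorem mem_of_zsmul_mem [CharZero F] {V : Type*} [AddCommGroup V] [Module F V]
    {T : Submodule F V} {k : ℤ} (hk : k ≠ 0) {x : V} (h : k • x ∈ T) : x ∈ T := by
  rw [← Int.cast_smul_eq_zsmul F] at h
  exact (T.smul_mem_iff (Int.cast_ne_zero.2 hk)).1 h

theorem rename_toPoly_sub_zsmul_mem {n : ℕ} {l : Comb (Fin n)} {l' : Comb ℕ} {k : ℤ}
    (h : Comb.isZeroComm (l.toNat ++ l'.scale (-k)) = true) (g : ℕ → X) :
    Poly.rename (g ∘ Fin.val) (l.toPoly F) - k • Poly.rename g (l'.toPoly F) ∈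
      lowerConsequences F X := by
  have h_mem := toPoly_mem_of_isZeroComm (F := F) g h
  rw [← Comb.rename_toPoly, Comb.toPoly_append, Comb.toPoly_scale, map_add, map_zsmul, neg_smul,
    ← sub_eq_add_neg, Comb.toNat, Comb.rename_toPoly, Comb.mapMon_mapMon] at h_mem
  rw [Comb.rename_toPoly]
  simpa only [Function.comp_def, Mon.map_map] using h_mem

section Relations

variable [CharZero F]

theorem toPoly_mem_of_multiple {n : ℕ} {l : Comb (Fin n)} {l' : Comb ℕ} {k : ℤ}
    (hk : k ≠ 0) (hl : l.toPoly F ∈ lowerConsequences F (Fin n))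
    (h : Comb.isZeroComm (l.toNat ++ l'.scale (-k)) = true) :
    l'.toPoly F ∈ lowerConsequences F ℕ := by
  have h_sub := rename_toPoly_sub_zsmul_mem (F := F) h id
  have h_mem := sub_mem (rename_mem_consequences _ (id ∘ Fin.val) hl) h_sub
  have rename_id : Poly.rename id (l'.toPoly F) = l'.toPoly F := by
    simp [Comb.rename_toPoly, Comb.mapMon, Mon.map_id]
  rw [sub_sub_cancel, rename_id] at h_mem
  exact mem_of_zsmul_mem hk h_mem

theorem jordanLin_isZeroComm (o : Op) : Comb.isZeroComm ((jordanLin o).toNat ++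
    (jordanTerms o (.var 0) (.var 1) (.var 2) (.var 3)).scale (-2)) = true := by
  cases o <;> decide +kernel

theorem newLin4_isZeroComm : Comb.isZeroComm (newLin4.toNat ++
    (newTerms4 (.var 0) (.var 1) (.var 2) (.var 3)).scale (-8)) = true := by
  decide +kernel

theorem jordanTerms_mem_lowerConsequences (o : Op) :
    (jordanTerms o (.var 0) (.var 1) (.var 2) (.var 3)).toPoly F ∈ lowerConsequences F ℕ := by
  refine toPoly_mem_of_multiple two_ne_zero ?_ (jordanLin_isZeroComm o)
  rw [← linearize_jordanIdentity]
  exact lowerList_mem_lowerConsequences (.jordan o)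

theorem newTerms4_mem_lowerConsequences :
    (newTerms4 (.var 0) (.var 1) (.var 2) (.var 3)).toPoly F ∈ lowerConsequences F ℕ := by
  refine toPoly_mem_of_multiple (by norm_num) ?_ newLin4_isZeroComm
  rw [← linearize_newJJ4]
  exact lowerList_mem_lowerConsequences .new4

theorem Rel.comb_mem_lowerConsequences (r : Rel) (g : ℕ → X) :
    (r.comb.mapMon (Mon.map g)).toPoly F ∈ lowerConsequences F X := by
  have instance_mem (x y z w : Mon ℕ) {l : Comb ℕ} (h : l.toPoly F ∈ lowerConsequences F ℕ) :=
    subst_consequences h fun i => Finsupp.single (([x, y, z, w].getD i x).map g) 1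
  induction r with
  | jordan o x y z w =>
    have h := instance_mem x y z w (jordanTerms_mem_lowerConsequences o)
    rwa [Comb.subst_toPoly] at h
  | interchange x y z w =>
    have h := instance_mem x y z w newTerms4_mem_lowerConsequences
    rwa [Comb.subst_toPoly] at h
  | under o x r ih =>
    rw [Rel.comb, ← Comb.rename_toPoly, Comb.toPoly_mul, Poly.rename_mul, Comb.rename_toPoly,
      Comb.rename_toPoly]
    exact (isIdeal_lowerConsequences o _ _ ih).1

end Relations

/-! ### The ideal of the free associative interchange algebra -/

theorem map_mem_of_map_single_mem {V : Type*} [AddCommGroup V] [Module F V] {I : Submodule F V}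
    (L : Poly F X →ₗ[F] V) (h : ∀ m, L (Finsupp.single m 1) ∈ I) (x : Poly F X) : L x ∈ I := by
  induction x using Finsupp.induction_linear with
  | zero => simp
  | add x y hx hy =>
    rw [map_add]
    exact add_mem hx hy
  | single m c =>
    rw [← mul_one c, ← smul_eq_mul, ← Finsupp.smul_single, map_smul]
    exact I.smul_mem c (h m)

theorem isIdeal_span_of_mul_single_mem {S : Set (Poly F X)}
    (hS : ∀ o m, ∀ f ∈ S, Poly.mul F X o (Finsupp.single m 1) f ∈ S ∧
      Poly.mul F X o f (Finsupp.single m 1) ∈ S) :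
    IsIdeal (Poly.mul F X) (Submodule.span F S) := fun o x y hy => by
  constructor
  · refine map_mem_of_map_single_mem ((Poly.mul F X o).flip y) (fun m => ?_) x
    have h : Submodule.span F S ≤ (Submodule.span F S).comap (Poly.mul F X o (.single m 1)) :=
      Submodule.span_le.2 fun f hf => Submodule.subset_span (hS o m f hf).1
    exact h hy
  · refine map_mem_of_map_single_mem (Poly.mul F X o y) (fun m => ?_) x
    have h : Submodule.span F S ≤
        (Submodule.span F S).comap ((Poly.mul F X o).flip (.single m 1)) :=
      Submodule.span_le.2 fun f hf => Submodule.subset_span (hS o m f hf).2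
    exact h hy

variable (F X) in
/-- The span of the differences of two monomials that are related by a single application of
associativity or of the interchange identity. -/
noncomputable def stepSpan : Submodule F (Poly F X) :=
  Submodule.span F
    {f | ∃ m : Mon X, ∃ m' ∈ m.steps, f = Finsupp.single m 1 - Finsupp.single m' 1}

theorem isIdeal_stepSpan : IsIdeal (Poly.mul F X) (stepSpan F X) := by
  refine isIdeal_span_of_mul_single_mem ?_
  rintro o u _ ⟨m, m', h, rfl⟩
  simp only [map_sub, LinearMap.sub_apply, Poly.mul_single_single]
  exact ⟨⟨_, .mul o u m', by simp [Mon.steps, h], rfl⟩,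
    ⟨_, .mul o m' u, by simp [Mon.steps, h], rfl⟩⟩

theorem assoc_mem_stepSpan (o : Op) (x y z : Poly F X) :
    Poly.mul F X o (Poly.mul F X o x y) z - Poly.mul F X o x (Poly.mul F X o y z) ∈
      stepSpan F X := by
  let J := Poly.mul F X o
  refine map_mem_of_map_single_mem (J.flip z ∘ₗ J.flip y - J.flip (J y z)) (fun u => ?_) x
  refine map_mem_of_map_single_mem (J.flip z ∘ₗ J (.single u 1) - J (.single u 1) ∘ₗ J.flip z)
    (fun v => ?_) y
  refine map_mem_of_map_single_mem (J (J (.single u 1) (.single v 1)) -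
    J (.single u 1) ∘ₗ J (.single v 1)) (fun w => ?_) z
  simp only [J, LinearMap.sub_apply, LinearMap.comp_apply, Poly.mul_single_single]
  exact Submodule.subset_span ⟨_, _, by cases o <;> simp [Mon.steps, Mon.assocStep], rfl⟩

theorem interchange_mem_stepSpan (x y z w : Poly F X) :
    Poly.mul F X .bullet (Poly.mul F X .circ x y) (Poly.mul F X .circ z w) -
      Poly.mul F X .circ (Poly.mul F X .bullet x z) (Poly.mul F X .bullet y w) ∈ stepSpan F X := by
  let C := Poly.mul F X .circ
  let B := Poly.mul F X .bullet
  refine map_mem_of_map_single_mem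
    (B.flip (C z w) ∘ₗ C.flip y - C.flip (B y w) ∘ₗ B.flip z) (fun s => ?_) x
  refine map_mem_of_map_single_mem
    (B.flip (C z w) ∘ₗ C (.single s 1) - C (B (.single s 1) z) ∘ₗ B.flip w) (fun t => ?_) y
  refine map_mem_of_map_single_mem
    (B (C (.single s 1) (.single t 1)) ∘ₗ C.flip w - C.flip (B (.single t 1) w) ∘ₗ B (.single s 1))
    (fun u => ?_) z
  refine map_mem_of_map_single_mem
    (B (C (.single s 1) (.single t 1)) ∘ₗ C (.single u 1) -
      C (B (.single s 1) (.single u 1)) ∘ₗ B (.single t 1)) (fun v => ?_) w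
  simp only [C, B, LinearMap.sub_apply, LinearMap.comp_apply, Poly.mul_single_single]
  exact Submodule.subset_span ⟨_, _, by simp [Mon.steps, Mon.interchangeStep], rfl⟩

theorem interchangeIdeal_le_stepSpan : interchangeIdeal F X ≤ stepSpan F X := by
  refine consequences_le isIdeal_stepSpan fun n f hf φ => ?_
  cases hf with
  | assoc o =>
    simp only [map_sub, Poly.subst_mul, Poly.subst_var]
    exact assoc_mem_stepSpan o (φ 0) (φ 1) (φ 2)
  | interchange =>
    simp only [map_sub, Poly.subst_mul, Poly.subst_var]
    exact interchange_mem_stepSpan (φ 0) (φ 1) (φ 2) (φ 3)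

/-! ### Expansion and symmetrization -/

variable (F X) in
/-- The expansion of the Jordan products. -/
noncomputable def expandMap : Poly F X →ₗ[F] Poly F X :=
  Poly.eval (jordan (Poly.mul F X)) Poly.var

theorem map_eval_jordan {A B : Type*} [AddCommGroup A] [Module F A] [AddCommGroup B] [Module F B]
    {op : BilinOps F A} {op' : BilinOps F B} (h : A →ₗ[F] B)
    (map_op : ∀ o x y, h (op o x y) = op' o (h x) (h y)) (a : X → A) (f : Poly F X) :
    h (f.eval (jordan op) a) = f.eval (jordan op') fun x => h (a x) := by
  have : h.comp (Poly.eval (jordan op) a) = Poly.eval (jordan op') fun x => h (a x) := by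
    refine Finsupp.lhom_ext' fun m => LinearMap.ext_ring ?_
    simp only [LinearMap.comp_apply, Finsupp.lsingle_apply, Poly.eval_single]
    induction m with
    | var x => rfl
    | mul o l r hl hr =>
      rw [Mon.eval, Mon.eval, ← hl, ← hr]
      simp [jordan, map_op]
  exact LinearMap.congr_fun this f

theorem expandMap_mem_interchangeIdeal [Countable X] [Nonempty X] {f : Poly F X}
    (hf : IsIdentity (jordan (FreeAI.op F ℕ)) f) :
    expandMap F X f ∈ interchangeIdeal F X := by
  obtain ⟨g, hg⟩ := exists_injective_nat X
  have h := hf fun x => (interchangeIdeal F ℕ).mkQ (Poly.var (g x))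
  rw [← map_eval_jordan (op := Poly.mul F ℕ) _ FreeAI.op_mk] at h
  have h_rename := rename_mem_consequences _ (Function.invFun g)
    ((Submodule.Quotient.mk_eq_zero _).1 h)
  rw [map_eval_jordan _ (Poly.rename_mul (F := F) (Function.invFun g))] at h_rename
  simp only [Poly.var, Poly.rename_single, Mon.map, Function.leftInverse_invFun hg _] at h_rename
  exact h_rename

theorem expandMap_single (m : Mon X) : expandMap F X (Finsupp.single m 1) =
    (m.expand.map fun t => (Finsupp.single t 1 : Poly F X)).sum := by
  rw [expandMap, Poly.eval_single, eval_jordan]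
  congr 2
  funext t
  induction t with
  | var x => rfl
  | mul o l r hl hr => rw [Mon.eval, hl, hr, Poly.mul_single_single]

theorem expandMap_single_eq_of_commEq {m n : Mon X} (h : Mon.CommEq m n) :
    expandMap F X (Finsupp.single m 1) = expandMap F X (Finsupp.single n 1) := by
  simp only [expandMap, Poly.eval_single]
  induction h with
  | refl m => rfl
  | mul o _ _ hl hr => rw [Mon.eval, Mon.eval, hl, hr]
  | comm o _ _ hl hr =>
    rw [Mon.eval, Mon.eval, hl, hr]
    simp [jordan, add_comm]

theorem symmetrize_map (n : ℕ) (g : X → Y) (m : Mon X) :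
    symmetrize n (m.map g) = (symmetrize n m).mapMon (Mon.map g) := by
  have leaf_map : (m.map g).leaf = g ∘ m.leaf := funext (Mon.leaf_map g m)
  simp only [symmetrize, Comb.mapMon_mapMon, Mon.relabel_map, leaf_map, Function.comp_def,
    Mon.map_map]

variable (F X) in
/-- The linear extension of `symmetrize` in degree `n`, which vanishes in all other degrees. -/
noncomputable def symmetrizeMap (n : ℕ) : Poly F X →ₗ[F] Poly F X :=
  Finsupp.linearCombination F fun m => if m.size = n then (symmetrize n m).toPoly F else 0

theorem symmetrizeMap_single {n : ℕ} {m : Mon X} (hm : m.size = n) :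
    symmetrizeMap F X n (Finsupp.single m 1) = (symmetrize n m).toPoly F := by
  simp [symmetrizeMap, hm]

theorem symmetrize_sub_mem_lowerConsequences {n : ℕ} (hn : invarianceTest n = true) {m m' : Mon X}
    (hm : m.size = n) (h : m' ∈ m.steps) :
    (symmetrize n m).toPoly F - (symmetrize n m').toPoly F ∈ lowerConsequences F X := by
  have h_shape := m.relabel_mem_shapes 0 hm.le
  rw [hm] at h_shape
  obtain ⟨s', h_step, rfl⟩ : ∃ s' ∈ (m.relabel 0).steps, s'.map m.leaf = m' := by
    rwa [← m.map_relabel, Mon.steps_map, List.mem_map] at h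
  have h_test := List.all_eq_true.1 (List.all_eq_true.1 hn _ h_shape) _ h_step
  have h_mem := toPoly_mem_of_isZeroComm (F := F) m.leaf h_test
  rwa [← Comb.rename_toPoly, Comb.toPoly_append, Comb.toPoly_scale, map_add, map_zsmul,
    Comb.rename_toPoly, Comb.rename_toPoly, ← symmetrize_map, ← symmetrize_map,
    m.map_relabel, neg_one_zsmul, ← sub_eq_add_neg] at h_mem

theorem symmetrizeMap_mem_lowerConsequences {n : ℕ} (hn : invarianceTest n = true) {f : Poly F X}
    (hf : f ∈ interchangeIdeal F X) : symmetrizeMap F X n f ∈ lowerConsequences F X := by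
  have h : stepSpan F X ≤ (lowerConsequences F X).comap (symmetrizeMap F X n) := by
    refine Submodule.span_le.2 ?_
    rintro _ ⟨m, m', h, rfl⟩
    have size_eq := Mon.size_of_mem_steps h
    rw [SetLike.mem_coe, Submodule.mem_comap, map_sub]
    by_cases hm : m.size = n
    · rw [symmetrizeMap_single hm, symmetrizeMap_single (size_eq.trans hm)]
      exact symmetrize_sub_mem_lowerConsequences hn hm h
    · simp [symmetrizeMap, size_eq, hm]
  exact h (interchangeIdeal_le_stepSpan hf)

theorem symmetrizeMap_expandMap_single {n : ℕ} {m : Mon X} (hm : m.size = n) :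
    symmetrizeMap F X n (expandMap F X (Finsupp.single m 1)) =
      Comb.toPoly F (m.expand.flatMap (symmetrize n)) := by
  rw [expandMap_single, map_list_sum, List.map_map, Comb.toPoly, Comb.val_flatMap]
  congr 1
  exact List.map_congr_left fun t ht =>
    symmetrizeMap_single ((Mon.size_of_mem_expand ht).trans hm)

theorem expand_flatMap_symmetrize_map (n : ℕ) (g : X → Y) (m : Mon X) :
    (m.map g).expand.flatMap (symmetrize n) =
      Comb.mapMon (Mon.map g) (m.expand.flatMap (symmetrize n)) := by
  simp only [Mon.expand_map, List.flatMap_map, symmetrize_map, Comb.mapMon, List.map_flatMap]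

theorem Comb.toPoly_flatMap_mem {A : Type*} {T : Submodule F (Poly F X)} {l : List A}
    {f : A → Comb X} (h : ∀ a ∈ l, (f a).toPoly F ∈ T) : Comb.toPoly F (l.flatMap f) ∈ T := by
  rw [Comb.toPoly, Comb.val_flatMap]
  exact list_sum_mem (by simpa [Comb.toPoly] using h)

section

variable [CharZero F] {T : Submodule F (Poly F X)}

theorem certificate_mem (hT : lowerConsequences F X ≤ T) (g : ℕ → X) {m : Mon ℕ}
    (hooks_mem : ∀ p ∈ hooksOf m, ((hook p.2.1 p.2.2).mapMon (Mon.map g)).toPoly F ∈ T) :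
    ((certificate m).mapMon (Mon.map g)).toPoly F ∈ T := by
  rw [certificate, ← Comb.rename_toPoly, Comb.toPoly_append, map_add]
  refine add_mem (Comb.toPoly_flatMap_mem (T := T.comap (Poly.rename g)) fun p _ => ?_)
    (Comb.toPoly_flatMap_mem (T := T.comap (Poly.rename g)) fun p hp => ?_)
  · rw [Submodule.mem_comap, Comb.toPoly_scale, map_zsmul, Comb.rename_toPoly]
    exact T.smul_of_tower_mem _ (hT (p.2.comb_mem_lowerConsequences _))
  · rw [Submodule.mem_comap, Comb.toPoly_scale, map_zsmul, Comb.rename_toPoly]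
    exact T.smul_of_tower_mem _ (hooks_mem p hp)

theorem Mon.IsOriented.factor_smul_sub_mem {n : ℕ} (hn : inverseTest n = true) {m : Mon X}
    (hm : m.size = n) (h_oriented : m.IsOriented) (hT : lowerConsequences F X ≤ T)
    (hooks_mem : ∀ p ∈ hooksOf (m.relabel 0),
      ((hook p.2.1 p.2.2).mapMon (Mon.map m.leaf)).toPoly F ∈ T) :
    Symmetrize.factor n • Finsupp.single m (1 : F) -
      symmetrizeMap F X n (expandMap F X (Finsupp.single m 1)) ∈ T := by
  have h_shape := m.relabel_mem_shapes 0 hm.le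
  rw [hm] at h_shape
  have h_test := List.all_eq_true.1 hn _ h_shape
  rw [(h_oriented.relabel 0).orient_eq, beq_self_eq_true, Bool.not_true, Bool.false_or] at h_test
  have h_zero := hT (toPoly_mem_of_isZeroComm (F := F) m.leaf h_test)
  rw [← Comb.rename_toPoly, Comb.toPoly_append, map_add, Comb.rename_toPoly,
    ← expand_flatMap_symmetrize_map, m.map_relabel, ← symmetrizeMap_expandMap_single hm,
    Comb.toPoly, Comb.val_cons, map_add, map_zsmul, Poly.rename_single, m.map_relabel] at h_zero
  have h_cert := certificate_mem hT m.leaf hooks_mem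
  rw [← Comb.rename_toPoly] at h_cert
  convert sub_mem h_cert h_zero using 1
  rw [Comb.toPoly, neg_smul]
  abel

theorem factor_smul_sub_mem {n : ℕ} (hn : inverseTest n = true) {m : Mon X}
    (hm : m.size = n) (hT : lowerConsequences F X ≤ T)
    (hooks_mem : ∀ p ∈ hooksOf (m.orient.relabel 0),
      ((hook p.2.1 p.2.2).mapMon (Mon.map m.orient.leaf)).toPoly F ∈ T) :
    Symmetrize.factor n • Finsupp.single m (1 : F) -
      symmetrizeMap F X n (expandMap F X (Finsupp.single m 1)) ∈ T := by
  have h_oriented :=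
    m.isOriented_orient.factor_smul_sub_mem hn (m.size_orient.trans hm) hT hooks_mem
  rw [expandMap_single_eq_of_commEq m.commEq_orient] at h_oriented
  have h_comm := T.smul_of_tower_mem (Symmetrize.factor n)
    (hT (single_sub_single_mem_lowerConsequences (F := F) m.commEq_orient))
  rw [smul_sub] at h_comm
  convert sub_mem h_oriented h_comm using 1
  abel

end

/-! ### The identities of degree at most five -/

theorem Mon.sum_count {n : ℕ} (m : Mon (Fin n)) : ∑ i, m.count i = m.size := by
  induction m with
  | var x => exact (Fintype.sum_eq_single x fun i hi => if_neg hi.symm).trans (if_pos rfl)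
  | mul o l r hl hr => simp [count, size, Finset.sum_add_distrib, hl, hr]

theorem Mon.IsMultilinear.size_eq {n : ℕ} {m : Mon (Fin n)} (h : m.IsMultilinear) :
    m.size = n := by
  rw [← m.sum_count, Finset.sum_congr rfl fun i _ => h i]
  simp

theorem Mon.IsMultilinear.relabel_mem_shapes {n : ℕ} {m : Mon (Fin n)} (h : m.IsMultilinear) :
    m.relabel 0 ∈ shapes n n 0 := by
  have h_shape := m.relabel_mem_shapes 0 h.size_eq.le
  rwa [h.size_eq] at h_shape

theorem Mon.IsMultilinear.exists_perm {n : ℕ} {m : Mon (Fin n)} (h : m.IsMultilinear) :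
    ∃ s : Equiv.Perm (Fin n), ∀ i : Fin n, m.leaf i = s i := by
  have surjective_leaf : Function.Surjective fun i : Fin n => m.leaf i := fun x => by
    have hx : x ∈ m.leaves := List.count_pos_iff.1 (by rw [← m.count_eq_count_leaves, h x]; simp)
    obtain ⟨j, hj, rfl⟩ := List.getElem_of_mem hx
    exact ⟨⟨j, by rwa [m.length_leaves, h.size_eq] at hj⟩, List.getD_eq_getElem _ _ hj⟩
  exact ⟨Equiv.ofBijective _ (Finite.surjective_iff_bijective.1 surjective_leaf), fun _ => rfl⟩

theorem Mon.CommEq.count_eq {m n : Mon X} (h : CommEq m n) (x : X) : m.count x = n.count x := by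
  induction h with
  | refl m => rfl
  | mul o _ _ hl hr => simp [count, hl, hr]
  | comm o _ _ hl hr => simp [count, hl, hr, add_comm]

theorem Mon.IsMultilinear.orient {m : Mon X} (h : m.IsMultilinear) : m.orient.IsMultilinear :=
  fun x => (m.commEq_orient.count_eq x).trans (h x)

theorem Symmetrize.factor_ne_zero (n : ℕ) : factor n ≠ 0 := by
  unfold factor
  split <;> norm_num

theorem newLin5_isZeroComm (o : Op) :
    Comb.isZeroComm ((newLin5 o).toNat ++ (newTerms5 o).scale (-2)) = true := by
  cases o <;> decide +kernel

theorem permRep_linJJ5_sub_hook_mem (o : Op) (i : Fin 5) {g : ℕ → Fin 5} {s : Equiv.Perm (Fin 5)}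
    (hg : ∀ j : Fin 5, g j = s j) :
    permRep F 5 (s * Equiv.swap i 4) (linJJ5 F o) -
      (2 : ℤ) • ((hook o i).mapMon (Mon.map g)).toPoly F ∈ lowerConsequences F (Fin 5) := by
  have g_swap : (g ∘ Equiv.swap (i : ℕ) 4) ∘ Fin.val = s * Equiv.swap i 4 :=
    funext fun j => (congrArg g (Fin.val_injective.swap_apply i 4 j)).trans (hg _)
  have h_sub := rename_toPoly_sub_zsmul_mem (F := F) (newLin5_isZeroComm o)
    (g ∘ Equiv.swap (i : ℕ) 4)
  rw [g_swap, ← linJJ5_eq, Comb.rename_toPoly] at h_sub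
  rw [hook, Comb.mapMon_mapMon]
  simpa [Function.comp_def, Mon.map_map, permRep] using h_sub

section

variable [CharZero F]

theorem mem_of_mem_allIdentities {n : ℕ} (h_invariance : invarianceTest n = true)
    (h_inverse : inverseTest n = true) {T : Submodule F (Poly F (Fin n))}
    (hT : lowerConsequences F (Fin n) ≤ T)
    (hooks_mem : ∀ m : Mon (Fin n), m.IsMultilinear → ∀ p ∈ hooksOf (m.relabel 0),
      ((hook p.2.1 p.2.2).mapMon (Mon.map m.leaf)).toPoly F ∈ T)
    {f : Poly F (Fin n)} (hf : f ∈ allIdentities F n) : f ∈ T := by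
  rcases isEmpty_or_nonempty (Fin n) with h_empty | h_nonempty
  · rw [show f = 0 from Finsupp.ext fun m => isEmptyElim m.first]
    exact T.zero_mem
  have h_sub : multilinear F n ≤ T.comap (Symmetrize.factor n • LinearMap.id -
      symmetrizeMap F (Fin n) n ∘ₗ expandMap F (Fin n)) := by
    rw [multilinear, Finsupp.supported_eq_span_single, Submodule.span_le]
    rintro _ ⟨m, hm, rfl⟩
    exact factor_smul_sub_mem h_inverse hm.size_eq hT (hooks_mem _ hm.orient)
  have h_symmetrize : symmetrizeMap F (Fin n) n (expandMap F (Fin n) f) ∈ T :=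
    hT (symmetrizeMap_mem_lowerConsequences h_invariance (expandMap_mem_interchangeIdeal hf.2))
  refine mem_of_zsmul_mem (Symmetrize.factor_ne_zero n) ?_
  simpa using add_mem (Submodule.mem_comap.1 (h_sub hf.1)) h_symmetrize

theorem mem_lowerConsequences_of_mem_allIdentities {n : ℕ} (hn : n < 5) {f : Poly F (Fin n)}
    (hf : f ∈ allIdentities F n) : f ∈ lowerConsequences F (Fin n) := by
  have mem_of_tests (no_hooks : (Mon.shapes n n 0).all (fun s => (hooksOf s).isEmpty) = true)
      (h_invariance : invarianceTest n = true) (h_inverse : inverseTest n = true) :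
      f ∈ lowerConsequences F (Fin n) := by
    refine mem_of_mem_allIdentities h_invariance h_inverse le_rfl (fun m hm p hp => ?_) hf
    rw [List.isEmpty_iff.1 (List.all_eq_true.1 no_hooks _ hm.relabel_mem_shapes)] at hp
    exact absurd hp List.not_mem_nil
  interval_cases n <;>
    exact mem_of_tests (by decide +kernel) (by decide +kernel) (by decide +kernel)

variable (F) in
/-- The span of the linearizations of `newJJ51` (for `o = .circ`) or `newJJ52` (for `o = .bullet`)
in all orders of the variables. -/
noncomputable def hookSpan (o : Op) : Submodule F (Poly F (Fin 5)) :=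
  Submodule.span F (Set.range fun s => permRep F 5 s (linJJ5 F o))

theorem hook_mem_sup_hookSpan {m : Mon (Fin 5)} (hm : m.IsMultilinear) (o : Op) (i : Fin 5) :
    ((hook o i).mapMon (Mon.map m.leaf)).toPoly F ∈
      lowerConsequences F (Fin 5) ⊔ hookSpan F o := by
  obtain ⟨s, hs⟩ := hm.exists_perm
  have h_span : permRep F 5 (s * Equiv.swap i 4) (linJJ5 F o) ∈ hookSpan F o :=
    Submodule.subset_span ⟨_, rfl⟩
  have h_mem := sub_mem (Submodule.mem_sup_right h_span)
    (Submodule.mem_sup_left (permRep_linJJ5_sub_hook_mem o i hs))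
  rw [sub_sub_cancel] at h_mem
  exact mem_of_zsmul_mem two_ne_zero h_mem

end

theorem inverseTest_five : inverseTest 5 = true := by decide +kernel

theorem invarianceTest_five : invarianceTest 5 = true := by decide +kernel

theorem mem_sup_hookSpan [CharZero F] {f : Poly F (Fin 5)} (hf : f ∈ allIdentities F 5) :
    f ∈ lowerConsequences F (Fin 5) ⊔ (hookSpan F .circ ⊔ hookSpan F .bullet) := by
  refine mem_of_mem_allIdentities invarianceTest_five inverseTest_five le_sup_left
    (fun m hm p _ => ?_) hf
  have hookSpan_le : hookSpan F p.2.1 ≤ hookSpan F .circ ⊔ hookSpan F .bullet := by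
    cases p.2.1
    exacts [le_sup_left, le_sup_right]
  exact sup_le_sup_left hookSpan_le _ (hook_mem_sup_hookSpan hm p.2.1 p.2.2)

end Symmetrization

/-! ### The Specht module of the partition `(n - 1, 1)` -/

section Specht

variable {F : Type*} [Field F] {n : ℕ}

theorem naturalRep_single (s : Equiv.Perm (Fin n)) (i : Fin n) (c : F) :
    naturalRep F n s (Finsupp.single i c) = Finsupp.single (s i) c :=
  Finsupp.mapDomain_single

theorem naturalRep_swap_sub_self (i j : Fin n) (x : Fin n →₀ F) :
    x - naturalRep F n (Equiv.swap i j) x =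
      (x i - x j) • (Finsupp.single i 1 - Finsupp.single j 1) := by
  induction x using Finsupp.induction_linear with
  | zero => simp
  | add x y hx hy =>
    rw [map_add, add_sub_add_comm, hx, hy, ← add_smul, Finsupp.add_apply, Finsupp.add_apply]
    congr 1
    ring
  | single k c =>
    rw [naturalRep_single]
    rcases eq_or_ne k i with rfl | hi
    · rcases eq_or_ne k j with rfl | hj
      · simp
      · simp [smul_sub, hj]
    · rcases eq_or_ne k j with rfl | hj
      · simp [hi, smul_sub, neg_add_eq_sub]
      · simp [Equiv.swap_apply_of_ne_of_ne hi hj, hi, hj]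

theorem sum_eq_zero_of_mem_spechtHook {x : Fin n →₀ F} (hx : x ∈ (spechtHook F n).toSubmodule) :
    ∑ i, x i = 0 := by
  induction hx using Submodule.span_induction with
  | mem y hy =>
    obtain ⟨i, j, -, rfl⟩ := hy
    simp [Finsupp.single_apply]
  | zero => simp
  | add y z _ _ hy hz => simp [Finset.sum_add_distrib, hy, hz]
  | smul c y _ hy => simp [← Finset.mul_sum, hy]

theorem single_sub_single_mem_spechtHook (i j : Fin n) :
    Finsupp.single i 1 - Finsupp.single j 1 ∈ (spechtHook F n).toSubmodule := by
  rcases eq_or_ne i j with rfl | hij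
  · rw [sub_self]
    exact zero_mem _
  · exact Submodule.subset_span ⟨i, j, hij, rfl⟩

theorem spechtHook_le_of_single_sub_single_mem {U : Submodule F (Fin n →₀ F)}
    (hU : ∀ s, ∀ u ∈ U, naturalRep F n s u ∈ U) {i j : Fin n} (hij : i ≠ j)
    (h : Finsupp.single i 1 - Finsupp.single j 1 ∈ U) : (spechtHook F n).toSubmodule ≤ U := by
  refine Submodule.span_le.2 ?_
  rintro _ ⟨k, l, hkl, rfl⟩
  obtain ⟨s, rfl, rfl⟩ := MulAction.is_two_pretransitive_iff.1
    (Equiv.Perm.isMultiplyPretransitive (Fin n) 2) hij hkl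
  simpa [naturalRep_single] using hU s _ h

variable [CharZero F]

theorem spechtHook_le_of_mem {U : Submodule F (Fin n →₀ F)}
    (hU : ∀ s, ∀ u ∈ U, naturalRep F n s u ∈ U) {x : Fin n →₀ F} (hxU : x ∈ U)
    (hx : x ∈ (spechtHook F n).toSubmodule) (hx0 : x ≠ 0) : (spechtHook F n).toSubmodule ≤ U := by
  obtain ⟨i, j, hij⟩ : ∃ i j, x i ≠ x j := by
    by_contra! hconst
    refine hx0 (Finsupp.ext fun i => ?_)
    have hsum := sum_eq_zero_of_mem_spechtHook hx
    rw [Finset.sum_congr rfl fun j _ => hconst j i] at hsum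
    simpa [i.pos.ne'] using hsum
  refine spechtHook_le_of_single_sub_single_mem hU (fun h => hij (congrArg x h)) ?_
  rw [← Submodule.smul_mem_iff _ (sub_ne_zero.2 hij), ← naturalRep_swap_sub_self]
  exact sub_mem hxU (hU _ x hxU)

theorem isIrreducible_spechtHook (hn : 2 ≤ n) : Representation.IsIrreducible
    (V := (spechtHook F n).toSubmodule) (spechtHook F n).toRepresentation := by
  have hv := single_sub_single_mem_spechtHook (F := F) (⟨0, by lia⟩ : Fin n) ⟨1, by lia⟩
  have hv0 : Finsupp.single (⟨0, by lia⟩ : Fin n) (1 : F) - Finsupp.single ⟨1, by lia⟩ 1 ≠ 0 := by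
    simp [sub_eq_zero, Finsupp.single_left_inj]
  have : Nontrivial (Subrepresentation (spechtHook F n).toRepresentation) :=
    ⟨⊥, ⊤, fun h => hv0 (congrArg Subtype.val ((Submodule.mem_bot F).1
      ((congrArg Subrepresentation.toSubmodule h).ge (Submodule.mem_top (x := ⟨_, hv⟩)))))⟩
  refine ⟨fun U => or_iff_not_imp_left.2 fun hU => ?_⟩
  obtain ⟨u, hu, hu0⟩ := Submodule.exists_mem_ne_zero_of_ne_bot fun h : U.toSubmodule = ⊥ =>
    hU (Subrepresentation.toSubmodule_injective h)
  have hle : (spechtHook F n).toSubmodule ≤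
      U.toSubmodule.map (spechtHook F n).toSubmodule.subtype := by
    refine spechtHook_le_of_mem ?_ (Submodule.mem_map_of_mem hu) u.2
      fun h => hu0 (Subtype.ext h)
    rintro s _ ⟨w, hw, rfl⟩
    exact ⟨_, U.apply_mem_toSubmodule s hw, rfl⟩
  refine Subrepresentation.toSubmodule_injective (Submodule.eq_top_iff'.2 fun w => ?_)
  obtain ⟨u, hu, h⟩ := hle w.2
  exact Subtype.ext h ▸ hu

end Specht

open Representation in
theorem isIrreducible_of_equiv {F G V W : Type*} [Field F] [Monoid G] [AddCommGroup V] [Module F V]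
    [AddCommGroup W] [Module F W] {ρ : Representation F G V} {σ : Representation F G W}
    (e : ρ.Equiv σ) [σ.IsIrreducible] : ρ.IsIrreducible := by
  rw [irreducible_iff_isSimpleModule_asModule]
  exact IsSimpleModule.congr (LinearEquiv.ofBijective
    (IntertwiningMap.equivLinearMapAsModule ρ σ e.toIntertwiningMap) (EquivLike.bijective e))

theorem disjoint_of_isIrreducible {F G V : Type*} [Field F] [Group G] [AddCommGroup V] [Module F V]
    {ρ : Representation F G V} {W U : Subrepresentation ρ} (hW : W.toRepresentation.IsIrreducible)
    (h : ¬ W.toSubmodule ≤ U.toSubmodule) : Disjoint W.toSubmodule U.toSubmodule := by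
  let U' : Subrepresentation W.toRepresentation :=
    ⟨U.toSubmodule.submoduleOf W.toSubmodule, fun g _ hx => U.apply_mem_toSubmodule g hx⟩
  have hU' : U' = ⊥ := (eq_bot_or_eq_top U').resolve_right fun hU' =>
    h (Submodule.submoduleOf_eq_top.1 (congrArg Subrepresentation.toSubmodule hU'))
  exact Submodule.disjoint_iff_comap_eq_bot.2 (congrArg Subrepresentation.toSubmodule hU')

section PermutedVectors

variable {F V : Type*} [Field F] [AddCommGroup V] [Module F V] {n : ℕ}
  {ρ : Representation F (Equiv.Perm (Fin n)) V} {w : Fin n → V}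

theorem generatedBy_eq_span_range (hw : ∀ s i, ρ s (w i) = w (s i)) (k : Fin n) :
    (generatedBy ρ (w k)).toSubmodule = Submodule.span F (Set.range w) := by
  refine congrArg (Submodule.span F) (Set.ext fun v => ⟨?_, ?_⟩)
  · rintro ⟨s, rfl⟩
    exact ⟨s k, (hw s k).symm⟩
  · rintro ⟨i, rfl⟩
    exact ⟨Equiv.swap k i, (hw _ k).trans (congrArg w (Equiv.swap_apply_left k i))⟩

theorem nsmul_eq_sum_sub (hsum : ∑ i, w i = 0) (k : Fin n) : n • w k = ∑ i, (w k - w i) := by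
  simp [hsum]

/-- The map from the Specht module of the partition `(n - 1, 1)` to a representation that sends
`e i - e j` to `w i - w j`, for vectors `w i` that are permuted by the symmetric group. -/
noncomputable def spechtHookLift (hw : ∀ s i, ρ s (w i) = w (s i)) :
    (spechtHook F n).toRepresentation.IntertwiningMap ρ where
  toLinearMap := Finsupp.linearCombination F w ∘ₗ (spechtHook F n).toSubmodule.subtype
  isIntertwining' s := by
    have h : Finsupp.linearCombination F w ∘ₗ naturalRep F n s =
        ρ s ∘ₗ Finsupp.linearCombination F w := by
      refine Finsupp.lhom_ext' fun i => LinearMap.ext_ring ?_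
      simp [naturalRep_single, hw]
    exact LinearMap.ext fun x => DFunLike.congr_fun h x.1

theorem spechtHookLift_single_sub_single (hw : ∀ s i, ρ s (w i) = w (s i)) (i j : Fin n) :
    spechtHookLift hw ⟨_, single_sub_single_mem_spechtHook i j⟩ = w i - w j := by
  simp [spechtHookLift]

variable [CharZero F]

theorem range_spechtHookLift (hw : ∀ s i, ρ s (w i) = w (s i)) (hsum : ∑ i, w i = 0) (k : Fin n) :
    LinearMap.range (spechtHookLift hw).toLinearMap = (generatedBy ρ (w k)).toSubmodule := by
  rw [generatedBy_eq_span_range hw]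
  refine le_antisymm ?_ (Submodule.span_le.2 ?_)
  · rw [← Finsupp.range_linearCombination]
    exact LinearMap.range_comp_le_range _ _
  · rintro _ ⟨i, rfl⟩
    have hn : (n : F) ≠ 0 := Nat.cast_ne_zero.2 i.pos.ne'
    rw [SetLike.mem_coe, ← Submodule.smul_mem_iff _ hn, Nat.cast_smul_eq_nsmul,
      nsmul_eq_sum_sub hsum]
    exact Submodule.sum_mem _ fun j _ => ⟨_, spechtHookLift_single_sub_single hw i j⟩

theorem injective_spechtHookLift (hn : 2 ≤ n) (hw : ∀ s i, ρ s (w i) = w (s i))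
    (hsum : ∑ i, w i = 0) {k : Fin n} (hk : w k ≠ 0) : Function.Injective (spechtHookLift hw) := by
  have := isIrreducible_spechtHook (F := F) hn
  refine (Representation.IsIrreducible.injective_or_eq_zero
    (V := (spechtHook F n).toSubmodule) _).resolve_right fun h0 => hk ?_
  have hn : (n : F) ≠ 0 := Nat.cast_ne_zero.2 k.pos.ne'
  rw [← smul_eq_zero_iff_right hn, Nat.cast_smul_eq_nsmul, nsmul_eq_sum_sub hsum]
  refine Finset.sum_eq_zero fun i _ => ?_
  rw [← spechtHookLift_single_sub_single hw, h0]
  rfl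

theorem nonempty_generatedBy_equiv_spechtHook (hn : 2 ≤ n) (hw : ∀ s i, ρ s (w i) = w (s i))
    (hsum : ∑ i, w i = 0) {k : Fin n} (hk : w k ≠ 0) :
    Nonempty ((generatedBy ρ (w k)).toRepresentation.Equiv (spechtHook F n).toRepresentation) := by
  have hrange := range_spechtHookLift hw hsum k
  let e := (LinearEquiv.ofInjective _ (injective_spechtHookLift hn hw hsum hk)).trans
    (LinearEquiv.ofEq _ _ hrange)
  refine ⟨(Representation.Equiv.mk e fun s => LinearMap.ext fun x => Subtype.ext ?_).symm⟩
  exact DFunLike.congr_fun ((spechtHookLift hw).isIntertwining' s) x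

theorem isIrreducible_generatedBy (hn : 2 ≤ n) (hw : ∀ s i, ρ s (w i) = w (s i))
    (hsum : ∑ i, w i = 0) {k : Fin n} (hk : w k ≠ 0) :
    (generatedBy ρ (w k)).toRepresentation.IsIrreducible := by
  have := isIrreducible_spechtHook (F := F) hn
  obtain ⟨e⟩ := nonempty_generatedBy_equiv_spechtHook hn hw hsum hk
  exact isIrreducible_of_equiv (W := (spechtHook F n).toSubmodule) e

end PermutedVectors

/-! ### Subquotients -/

namespace SubQuot

variable {F V W : Type*} [Field F] [AddCommGroup V] [Module F V] [AddCommGroup W] [Module F W]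
  {p q : Submodule F V}

theorem exists_mk_eq (x : SubQuot p q) : ∃ (v : V) (hv : v ∈ p), mk v hv = x := by
  obtain ⟨⟨v, hv⟩, rfl⟩ := (q.submoduleOf p).mkQ_surjective x
  exact ⟨v, hv, rfl⟩

theorem mk_eq_zero {v : V} (hv : v ∈ p) (h : v ∈ q) : (mk v hv : SubQuot p q) = 0 :=
  (Submodule.Quotient.mk_eq_zero (q.submoduleOf p)).2 h

theorem mk_sum {ι : Type*} (s : Finset ι) {v : ι → V} (hv : ∀ i, v i ∈ p) :
    (mk (∑ i ∈ s, v i) (sum_mem fun i _ => hv i) : SubQuot p q) = ∑ i ∈ s, mk (v i) (hv i) := by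
  refine Eq.trans ?_ (map_sum (q.submoduleOf p).mkQ (fun i => (⟨v i, hv i⟩ : p)) s)
  exact congrArg (q.submoduleOf p).mkQ (Subtype.ext (by simp))

/-- The map on a subquotient of `p` by `q` that is induced by a linear map which vanishes on `q`. -/
noncomputable def lift (f : V →ₗ[F] W) (h : ∀ v ∈ q, f v = 0) : SubQuot p q →ₗ[F] W :=
  (q.submoduleOf p).liftQ (f ∘ₗ p.subtype) fun v hv => h v hv

theorem lift_mk (f : V →ₗ[F] W) (h : ∀ v ∈ q, f v = 0) {v : V} (hv : v ∈ p) :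
    (lift f h : SubQuot p q →ₗ[F] W) (mk v hv) = f v := rfl

end SubQuot

/-! ### An algebra that separates the new identities -/

/-- The products of the algebra with basis `a, b, a ∘ a, a ∘ b, a ∘ (a ∘ a), a • b, a • (a ∘ a), z`
(in this order), in which `(a ∘ b) • (a ∘ (a ∘ a)) = z = (a • b) ∘ (a • (a ∘ a))` and all further
products are determined by commutativity or zero. The Boolean tells `∘` from `•`. -/
def modelMul {R : Type*} [CommRing R] : Bool → (Fin 8 → R) → (Fin 8 → R) → Fin 8 → R
  | true, x, y => ![0, 0, x 0 * y 0, x 0 * y 1 + x 1 * y 0, x 0 * y 2 + x 2 * y 0, 0, 0,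
      x 5 * y 6 + x 6 * y 5]
  | false, x, y => ![0, 0, 0, 0, 0, x 0 * y 1 + x 1 * y 0, x 0 * y 2 + x 2 * y 0,
      x 3 * y 4 + x 4 * y 3]

section modelMul

variable {R : Type*} [CommRing R] (e : Bool)

theorem modelMul_true_apply (x y : Fin 8 → R) :
    modelMul true x y 0 = 0 ∧ modelMul true x y 1 = 0 ∧ modelMul true x y 2 = x 0 * y 0 ∧
      modelMul true x y 3 = x 0 * y 1 + x 1 * y 0 ∧ modelMul true x y 4 = x 0 * y 2 + x 2 * y 0 ∧
      modelMul true x y 5 = 0 ∧ modelMul true x y 6 = 0 ∧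
      modelMul true x y 7 = x 5 * y 6 + x 6 * y 5 :=
  ⟨rfl, rfl, rfl, rfl, rfl, rfl, rfl, rfl⟩

theorem modelMul_false_apply (x y : Fin 8 → R) :
    modelMul false x y 0 = 0 ∧ modelMul false x y 1 = 0 ∧ modelMul false x y 2 = 0 ∧
      modelMul false x y 3 = 0 ∧ modelMul false x y 4 = 0 ∧
      modelMul false x y 5 = x 0 * y 1 + x 1 * y 0 ∧
      modelMul false x y 6 = x 0 * y 2 + x 2 * y 0 ∧
      modelMul false x y 7 = x 3 * y 4 + x 4 * y 3 :=
  ⟨rfl, rfl, rfl, rfl, rfl, rfl, rfl, rfl⟩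

theorem modelMul_comm (x y : Fin 8 → R) : modelMul e x y = modelMul e y x := by
  cases e <;> simp only [modelMul, mul_comm, add_comm]

theorem modelMul_add (x y z : Fin 8 → R) :
    modelMul e x (y + z) = modelMul e x y + modelMul e x z := by
  cases e <;> funext i <;> fin_cases i <;> simp [modelMul_true_apply, modelMul_false_apply] <;> ring

theorem modelMul_smul (c : R) (x y : Fin 8 → R) :
    modelMul e x (c • y) = c • modelMul e x y := by
  cases e <;> funext i <;> fin_cases i <;> simp [modelMul_true_apply, modelMul_false_apply] <;> ring

theorem modelMul_map {S : Type*} [CommRing S] (g : R →+* S) (x y : Fin 8 → R) :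
    modelMul e (g ∘ x) (g ∘ y) = g ∘ modelMul e x y := by
  cases e <;> funext i <;> fin_cases i <;> simp [modelMul_true_apply, modelMul_false_apply]

end modelMul

section NewIdentities

variable {F : Type*} [Field F]

/-- The elements `a` and `b` of the algebra of `modelMul`: `b` if `j = i`, and `a` otherwise. -/
def modelPoint (R : Type*) [CommRing R] (i j : Fin 5) : Fin 8 → R :=
  Pi.single (bif j == i then 1 else 0) 1

variable (F) in
/-- The operations of `modelMul`, where `o` takes the role of `∘`. -/
noncomputable def modelOp (o : Op) : BilinOps F (Fin 8 → F) := fun p =>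
  LinearMap.mk₂ F (modelMul (o == p))
    (fun x y z => by simp only [modelMul_comm _ _ z, modelMul_add])
    (fun c x y => by simp only [modelMul_comm _ _ y, modelMul_smul])
    (modelMul_add _) (fun c x y => modelMul_smul _ c x y)

theorem modelOp_comm (o p : Op) (x y : Fin 8 → F) : modelOp F o p x y = modelOp F o p y x :=
  modelMul_comm _ x y

theorem eval_eq_of_commEq {X A : Type*} {op : Op → A → A → A} (hop : ∀ o x y, op o x y = op o y x)
    (a : X → A) {m n : Mon X} (h : Mon.CommEq m n) : m.eval op a = n.eval op a := by
  induction h with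
  | refl m => rfl
  | mul o _ _ hl hr => rw [Mon.eval, Mon.eval, hl, hr]
  | comm o _ _ hl hr => rw [Mon.eval, Mon.eval, hl, hr, hop]

theorem eval_toPoly_of_isZeroComm {A : Type*} [AddCommGroup A] [Module F A] {op : BilinOps F A}
    (hop : ∀ o x y, op o x y = op o y x) {n : ℕ} {l : Comb (Fin n)} {l' : Comb ℕ} {k : ℤ}
    (h : Comb.isZeroComm (l.toNat ++ l'.scale (-k)) = true) (a : ℕ → A) :
    (l.toPoly F).eval op (a ∘ Fin.val) = k • l'.val (Mon.eval (fun o x y => op o x y) a) := by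
  have h_val := Comb.val_eq_zero_of_comm (fun _ _ hmn => eval_eq_of_commEq hop a hmn) h
  rw [Comb.val_append, Comb.val_scale, neg_smul, ← sub_eq_add_neg, sub_eq_zero, Comb.toNat,
    Comb.val_mapMon] at h_val
  rw [Comb.eval_toPoly, ← h_val]
  simp only [Function.comp_def, Mon.eval_map]

theorem isIdentity_toPoly_modelOp (o : Op) {n : ℕ} [NeZero n] {l : Comb (Fin n)} {l' : Comb ℕ}
    {k : ℤ} (h : Comb.isZeroComm (l.toNat ++ l'.scale (-k)) = true)
    (h_val : ∀ a, l'.val (Mon.eval (fun p => modelMul (o == p)) a) = (0 : Fin 8 → F)) :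
    IsIdentity (modelOp F o) (l.toPoly F) := by
  intro a
  have ha : a = (fun i => a (Fin.ofNat n i)) ∘ Fin.val := by simp [Function.comp_def]
  rw [ha, eval_toPoly_of_isZeroComm (modelOp_comm o) h]
  exact (congrArg (k • ·) (h_val _)).trans (smul_zero k)

theorem isIdentity_modelOp (o : Op) {n : ℕ} {f : Poly F (Fin n)} (hf : LowerList F n f) :
    IsIdentity (modelOp F o) f := by
  cases hf with
  | comm p =>
    intro a
    rw [commutativity, map_sub, Poly.eval_mul, Poly.eval_mul, modelOp_comm, sub_self]
  | jordan p =>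
    rw [linearize_jordanIdentity]
    refine isIdentity_toPoly_modelOp o (jordanLin_isZeroComm p) fun a => ?_
    simp only [jordanTerms, Comb.val_cons, Comb.val_nil, Mon.eval]
    cases o == p <;> funext i <;> fin_cases i <;> simp [modelMul_true_apply, modelMul_false_apply]
  | new4 =>
    rw [linearize_newJJ4]
    refine isIdentity_toPoly_modelOp o newLin4_isZeroComm fun a => ?_
    simp only [newTerms4, Comb.val_cons, Comb.val_nil, Mon.b, Mon.c, Mon.eval]
    have circ_beq_bullet : (Op.circ == Op.bullet) = false := rfl
    have bullet_beq_circ : (Op.bullet == Op.circ) = false := rfl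
    cases o <;> funext i <;> fin_cases i <;>
      simp [circ_beq_bullet, bullet_beq_circ, modelMul_true_apply, modelMul_false_apply] <;>
      ring

variable (F) in
/-- The coefficient of `z` in the value of a polynomial in the algebra of `modelOp` at `b` for the
variable `i` and `a` for the other variables. -/
noncomputable def modelValue (o : Op) (i : Fin 5) : Poly F (Fin 5) →ₗ[F] F :=
  LinearMap.proj 7 ∘ₗ Poly.eval (modelOp F o) (modelPoint F i)

theorem modelValue_eq_zero (o : Op) (i : Fin 5) {f : Poly F (Fin 5)}
    (hf : f ∈ lowerConsequences F (Fin 5)) : modelValue F o i f = 0 :=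
  congrFun (isIdentity_of_mem_consequences (fun _ _ hf => isIdentity_modelOp o hf) hf _) 7

theorem modelValue_permRep (o : Op) (i : Fin 5) (s : Equiv.Perm (Fin 5)) (f : Poly F (Fin 5)) :
    modelValue F o i (permRep F 5 s f) = modelValue F o (s.symm i) f := by
  have hs : modelPoint F i ∘ s = modelPoint F (s.symm i) :=
    funext fun j => by simp [modelPoint, Bool.beq_eq_decide_eq, Equiv.eq_symm_apply]
  exact congrFun ((Poly.eval_rename _ _ s f).trans
    (congrArg (Poly.eval (modelOp F o) · f) hs)) 7

theorem modelValue_toPoly (o : Op) (i : Fin 5) (l : Comb (Fin 5)) :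
    modelValue F o i (l.toPoly F) =
      (l.val fun m => m.eval (fun p => modelMul (o == p)) (modelPoint ℤ i) 7 : ℤ) := by
  have eval_eq (m : Mon (Fin 5)) : m.eval (fun p => modelMul (o == p)) (modelPoint F i) =
      Int.castRingHom F ∘ m.eval (fun p => modelMul (o == p)) (modelPoint ℤ i) := by
    induction m with
    | var j =>
      funext k
      simp [Mon.eval, modelPoint, Pi.single_apply]
    | mul p l r hl hr => rw [Mon.eval, hl, hr, modelMul_map, Mon.eval]
  rw [Comb.toPoly, Comb.map_val]
  refine Eq.trans ?_ (Comb.map_val _ (Int.castAddHom F) l).symm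
  refine congrArg (Comb.val · l) (funext fun m => ?_)
  exact (congrFun (Poly.eval_single _ _ m) 7).trans (congrFun (eval_eq m) 7)

theorem modelValue_linJJ5_other (o : Op) (i : Fin 5) :
    modelValue F o i (linJJ5 F o.other) = 0 := by
  rw [linJJ5_eq, modelValue_toPoly]
  refine (congrArg Int.cast ?_).trans Int.cast_zero
  cases o <;> fin_cases i <;> decide +kernel

theorem modelValue_linJJ5_ne_zero [CharZero F] (o : Op) : modelValue F o 4 (linJJ5 F o) ≠ 0 := by
  rw [linJJ5_eq, modelValue_toPoly, Int.cast_ne_zero]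
  cases o <;> decide +kernel

/-! ### The new identities of degree five -/

theorem permRep_filter {n : ℕ} (s : Equiv.Perm (Fin n)) (f : Poly F (Fin n))
    [DecidablePred (Mon.IsMultilinear (X := Fin n))] :
    permRep F n s (f.filter Mon.IsMultilinear) = (permRep F n s f).filter Mon.IsMultilinear := by
  induction f using Finsupp.induction_linear with
  | zero => rw [Finsupp.filter_zero, map_zero, Finsupp.filter_zero]
  | add f g hf hg => rw [Finsupp.filter_add, map_add, map_add, Finsupp.filter_add, hf, hg]
  | single m c =>
    have permRep_single : permRep F n s (Finsupp.single m c) = Finsupp.single (m.map s) c :=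
      Finsupp.mapDomain_single
    have isMultilinear_map : (m.map s).IsMultilinear ↔ m.IsMultilinear := by
      simp only [Mon.IsMultilinear, Mon.count_map]
      exact (s.symm.surjective.forall (p := fun x => m.count x = 1)).symm
    rw [permRep_single]
    by_cases hm : m.IsMultilinear
    · rw [Finsupp.filter_single_of_pos _ hm,
        Finsupp.filter_single_of_pos _ (isMultilinear_map.2 hm), permRep_single]
    · rw [Finsupp.filter_single_of_neg _ hm,
        Finsupp.filter_single_of_neg _ (mt isMultilinear_map.1 hm), map_zero]

theorem permRep_linearize {n : ℕ} {X : Type*} {p : Fin n → X} {s : Equiv.Perm (Fin n)}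
    (hs : ∀ i, p (s i) = p i) (f : Poly F X) :
    permRep F n s (linearize p f) = linearize p f := by
  classical
  have rename_sum (x : X) : Poly.rename s (∑ i with p i = x, (Poly.var i : Poly F (Fin n))) =
      ∑ i with p i = x, Poly.var i := by
    rw [map_sum]
    exact Finset.sum_equiv s (fun i => by simp [hs]) fun i _ => Finsupp.mapDomain_single
  rw [linearize, permRep_filter]
  congr 1
  refine (Poly.rename_subst s _ f).trans ?_
  simp only [rename_sum]

theorem permRep_linJJ5 (o : Op) {s : Equiv.Perm (Fin 5)} (hs : s 4 = 4) :
    permRep F 5 s (linJJ5 F o) = linJJ5 F o := by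
  have apply_eq_ite (i : Fin 5) :
      (![0, 0, 0, 0, 1] : Fin 5 → Fin 2) i = if i = 4 then 1 else 0 := by
    fin_cases i <;> rfl
  have invariant (i : Fin 5) : (![0, 0, 0, 0, 1] : Fin 5 → Fin 2) (s i) =
      (![0, 0, 0, 0, 1] : Fin 5 → Fin 2) i := by
    rw [apply_eq_ite, apply_eq_ite]
    exact if_congr ⟨fun h => s.injective (h.trans hs.symm), fun h => h ▸ hs⟩ rfl rfl
  cases o <;> exact permRep_linearize invariant _

theorem apply_swap_apply {α V : Type*} [DecidableEq α] [AddCommGroup V] [Module F V]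
    {ρ : Representation F (Equiv.Perm α) V} {k : α} {v : V} (hv : ∀ s, s k = k → ρ s v = v)
    (s : Equiv.Perm α) (i : α) :
    ρ s (ρ (Equiv.swap k i) v) = ρ (Equiv.swap k (s i)) v := by
  have h := hv ((Equiv.swap k (s i))⁻¹ * (s * Equiv.swap k i)) (by simp)
  conv_rhs => rw [← h, ← Module.End.mul_apply, ← map_mul, mul_inv_cancel_left]
  rw [map_mul, Module.End.mul_apply]

/-- The interchange relations that express the vanishing of the sum of all `hook o i` modulo
relations of lower degree: one for every pair of variables that is multiplied by `o`. -/
def pairRels (o : Op) : List Rel :=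
  [(0, 1, 2, 3, 4), (0, 2, 1, 3, 4), (0, 3, 1, 2, 4), (0, 4, 1, 2, 3), (1, 2, 0, 3, 4),
    (1, 3, 0, 2, 4), (1, 4, 0, 2, 3), (2, 3, 0, 1, 4), (2, 4, 0, 1, 3), (3, 4, 0, 1, 2)].map
    fun ⟨i, j, x, y, z⟩ => .interchange (.mul o (.var i) (.var j)) (.var x) (.var y) (.var z)

theorem sum_hook_isZeroComm (o : Op) :
    Comb.isZeroComm ((List.finRange 5).flatMap (hook o) ++
      (pairRels o).flatMap fun r => r.comb.scale (-2)) = true := by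
  cases o <;> decide +kernel

section

variable [CharZero F]

theorem sum_hook_mem (o : Op) (g : ℕ → Fin 5) :
    ∑ i, ((hook o i).mapMon (Mon.map g)).toPoly F ∈ lowerConsequences F (Fin 5) := by
  have h_sum := toPoly_mem_of_isZeroComm (F := F) g (sum_hook_isZeroComm o)
  rw [← Comb.rename_toPoly, Comb.toPoly_append, map_add] at h_sum
  have h_rels := Comb.toPoly_flatMap_mem (F := F) (l := pairRels o)
    (f := fun r => r.comb.scale (-2))
    (T := (lowerConsequences F (Fin 5)).comap (Poly.rename g)) fun r _ => by
      rw [Submodule.mem_comap, Comb.toPoly_scale, map_zsmul, Comb.rename_toPoly]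
      exact zsmul_mem (r.comb_mem_lowerConsequences g) _
  have h_hooks := (Submodule.add_mem_iff_left _ (Submodule.mem_comap.1 h_rels)).1 h_sum
  rw [Comb.toPoly, Comb.val_flatMap, map_list_sum, List.map_map] at h_hooks
  simp only [← Comb.rename_toPoly, Fin.sum_univ_def]
  exact h_hooks

theorem sum_permRep_linJJ5_mem (o : Op) :
    ∑ i, permRep F 5 (Equiv.swap 4 i) (linJJ5 F o) ∈ lowerConsequences F (Fin 5) := by
  have h_sub (i : Fin 5) := permRep_linJJ5_sub_hook_mem (F := F) (g := Fin.ofNat 5) (s := 1) o i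
    (by decide)
  simp only [one_mul, Equiv.swap_comm _ (4 : Fin 5)] at h_sub
  have h_sum := sum_mem fun i (_ : i ∈ Finset.univ) => h_sub i
  rw [Finset.sum_sub_distrib, ← Finset.smul_sum] at h_sum
  exact (Submodule.sub_mem_iff_left _ (zsmul_mem (sum_hook_mem o _) 2)).1 h_sum

theorem oldIdentities_five :
    oldIdentities F 5 =
      multilinear F 5 ⊓ consequences (fun n => {g | LowerList F n g}) (Fin 5) := by
  refine le_antisymm (inf_le_inf_left _ ?_) (inf_le_inf_left _ ?_)
  · exact consequences_le_consequences fun n f hf =>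
      mem_lowerConsequences_of_mem_allIdentities hf.1 hf.2
  · refine consequences_le_consequences fun n f hf => ?_
    refine mem_consequences (S := fun k => {f | k < 5 ∧ f ∈ allIdentities F k})
      ⟨?_, lowerList_mem_allIdentities hf⟩
    cases hf <;> norm_num

theorem newClass_eq_zero {f : Poly F (Fin 5)} (hf : f ∈ allIdentities F 5)
    (h : f ∈ lowerConsequences F (Fin 5)) : newClass f hf = 0 := by
  refine SubQuot.mk_eq_zero _ ?_
  rw [oldIdentities_five]
  exact ⟨hf.1, h⟩

end

theorem newRep_newClass {n : ℕ} (s : Equiv.Perm (Fin n)) {f : Poly F (Fin n)}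
    (hf : f ∈ allIdentities F n) :
    newRep F n s (newClass f hf) = newClass (permRep F n s f) (permRep_mem_all s hf) := rfl

variable (F) in
/-- The class of `linJJ5 F o` with the variable `4`, which represents `b`, exchanged with `i`. -/
noncomputable def newHook (o : Op) (i : Fin 5) : NewIdentities F 5 :=
  newRep F 5 (Equiv.swap 4 i) (newClass (linJJ5 F o) (linJJ5_mem_allIdentities o))

theorem newHook_four (o : Op) :
    newHook F o 4 = newClass (linJJ5 F o) (linJJ5_mem_allIdentities o) := by
  rw [newHook, Equiv.swap_self, ← Equiv.Perm.one_def, map_one, Module.End.one_apply]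

theorem newRep_newHook (o : Op) (s : Equiv.Perm (Fin 5)) (i : Fin 5) :
    newRep F 5 s (newHook F o i) = newHook F o (s i) := by
  refine apply_swap_apply (fun s hs => ?_) s i
  rw [newRep_newClass]
  congr 1
  exact permRep_linJJ5 o hs

variable (F) in
/-- The subrepresentation generated by the class of a new identity. -/
noncomputable abbrev newGenerated (o : Op) : Subrepresentation (newRep F 5) :=
  generatedBy (newRep F 5) (newClass (linJJ5 F o) (linJJ5_mem_allIdentities o))

section

variable [CharZero F]

theorem sum_newHook (o : Op) : ∑ i, newHook F o i = 0 :=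
  (SubQuot.mk_sum Finset.univ fun i =>
    permRep_mem_all (Equiv.swap 4 i) (linJJ5_mem_allIdentities o)).symm.trans
    (newClass_eq_zero _ (sum_permRep_linJJ5_mem o))

variable (F) in
/-- The functional `modelValue F o 4` on the new identities. -/
noncomputable def newValue (o : Op) : NewIdentities F 5 →ₗ[F] F :=
  SubQuot.lift (modelValue F o 4) fun f hf => by
    rw [oldIdentities_five] at hf
    exact modelValue_eq_zero o 4 hf.2

theorem newValue_newClass (o : Op) {f : Poly F (Fin 5)} (hf : f ∈ allIdentities F 5) :
    newValue F o (newClass f hf) = modelValue F o 4 f := SubQuot.lift_mk _ _ _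

theorem newHook_four_ne_zero (o : Op) : newHook F o 4 ≠ 0 := fun h => by
  have h_value := congrArg (newValue F o) h
  rw [newHook_four, newValue_newClass, map_zero] at h_value
  exact modelValue_linJJ5_ne_zero o h_value

theorem isIrreducible_newGenerated (o : Op) :
    (newGenerated F o).toRepresentation.IsIrreducible := by
  rw [newGenerated, ← newHook_four]
  exact isIrreducible_generatedBy (by norm_num) (newRep_newHook o) (sum_newHook o)
    (newHook_four_ne_zero o)

theorem nonempty_newGenerated_equiv_spechtHook (o : Op) :
    Nonempty ((newGenerated F o).toRepresentation.Equiv (spechtHook F 5).toRepresentation) := by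
  rw [newGenerated, ← newHook_four]
  exact nonempty_generatedBy_equiv_spechtHook (by norm_num) (newRep_newHook o) (sum_newHook o)
    (newHook_four_ne_zero o)

theorem newGenerated_other_le_ker (o : Op) :
    (newGenerated F o.other).toSubmodule ≤ LinearMap.ker (newValue F o) := by
  refine Submodule.span_le.2 ?_
  rintro _ ⟨s, rfl⟩
  change newRep F 5 s (newClass _ _) ∈ LinearMap.ker (newValue F o)
  rw [newRep_newClass, LinearMap.mem_ker, newValue_newClass, modelValue_permRep,
    modelValue_linJJ5_other]

theorem disjoint_newGenerated :
    Disjoint (newGenerated F .circ).toSubmodule (newGenerated F .bullet).toSubmodule := by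
  refine disjoint_of_isIrreducible (isIrreducible_newGenerated .circ) fun h_le => ?_
  have h_gen : newClass (linJJ5 F .circ) (linJJ5_mem_allIdentities .circ) ∈
      (newGenerated F .circ).toSubmodule := Submodule.subset_span ⟨1, by simp⟩
  have h_value := newGenerated_other_le_ker .circ (h_le h_gen)
  rw [LinearMap.mem_ker, newValue_newClass] at h_value
  exact modelValue_linJJ5_ne_zero .circ h_value

end

theorem hookSpan_le_allIdentities (o : Op) : hookSpan F o ≤ allIdentities F 5 := by
  refine Submodule.span_le.2 ?_
  rintro _ ⟨s, rfl⟩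
  exact permRep_mem_all s (linJJ5_mem_allIdentities o)

theorem newClass_mem_newGenerated (o : Op) {f : Poly F (Fin 5)} (hf : f ∈ hookSpan F o) :
    newClass f (hookSpan_le_allIdentities o hf) ∈ (newGenerated F o).toSubmodule := by
  induction hf using Submodule.span_induction with
  | mem g hg =>
    obtain ⟨s, rfl⟩ := hg
    exact Submodule.subset_span ⟨s, rfl⟩
  | zero => exact zero_mem _
  | add g g' _ _ hg hg' => exact add_mem hg hg'
  | smul c g _ hg => exact Submodule.smul_mem _ c hg

theorem codisjoint_newGenerated [CharZero F] :
    Codisjoint (newGenerated F .circ).toSubmodule (newGenerated F .bullet).toSubmodule := by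
  rw [codisjoint_iff, Submodule.eq_top_iff']
  intro x
  obtain ⟨f, hf, rfl⟩ := x.exists_mk_eq
  obtain ⟨l, hl, r, hr, rfl⟩ := Submodule.mem_sup.1 (mem_sup_hookSpan hf)
  obtain ⟨c, hc, b, hb, rfl⟩ := Submodule.mem_sup.1 hr
  have hcb := add_mem (hookSpan_le_allIdentities _ hc) (hookSpan_le_allIdentities _ hb)
  have hl' : l ∈ allIdentities F 5 := ((allIdentities F 5).add_mem_iff_left hcb).1 hf
  have h_class : SubQuot.mk (l + (c + b)) hf = newClass l hl' +
      (newClass c (hookSpan_le_allIdentities _ hc) + newClass b (hookSpan_le_allIdentities _ hb)) :=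
    rfl
  rw [h_class, newClass_eq_zero hl' hl, zero_add]
  exact Submodule.add_mem_sup (newClass_mem_newGenerated _ hc) (newClass_mem_newGenerated _ hb)

theorem fullList_linJJ5 (o : Op) : FullList F 5 (linJJ5 F o) := by
  cases o
  exacts [.new51, .new52]

theorem FullList.isIdentity {n : ℕ} {f : Poly F (Fin n)} (hf : FullList F n f) :
    IsIdentity (jordan (FreeAI.op F ℕ)) f := by
  cases hf with
  | lower h => exact (lowerList_mem_allIdentities h).2
  | new51 => exact (linJJ5_mem_allIdentities .circ).2
  | new52 => exact (linJJ5_mem_allIdentities .bullet).2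

theorem hookSpan_le_consequences (o : Op) :
    hookSpan F o ≤ consequences (fun n => {g | FullList F n g}) (Fin 5) := by
  refine Submodule.span_le.2 ?_
  rintro _ ⟨s, rfl⟩
  exact rename_mem_consequences _ s
    (mem_consequences (S := fun n => {g | FullList F n g}) (fullList_linJJ5 o))

theorem lowerConsequences_le_consequences_fullList {X : Type*} :
    lowerConsequences F X ≤ consequences (fun n => {g | FullList F n g}) X :=
  consequences_le_consequences fun _ _ hf =>
    mem_consequences (S := fun n => {g | FullList F n g}) (FullList.lower hf)

theorem isIdentity_iff_mem_consequences_fullList [CharZero F] {f : Poly F (Fin 5)}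
    (hf : f ∈ multilinear F 5) :
    IsIdentity (jordan (FreeAI.op F ℕ)) f ↔
      f ∈ consequences (fun n => {g | FullList F n g}) (Fin 5) := by
  refine ⟨fun h => ?_, isIdentity_of_mem_consequences fun _ _ hg => FullList.isIdentity hg⟩
  have h_le := sup_le (lowerConsequences_le_consequences_fullList (F := F) (X := Fin 5))
    (sup_le (hookSpan_le_consequences .circ) (hookSpan_le_consequences .bullet))
  exact h_le (mem_sup_hookSpan ⟨hf, h⟩)

end NewIdentities

end JJ

theorem mainTheorem5 (F : Type*) [Field F] [CharZero F] :
    -- the degree five identities are exactly the consequences of the listed identities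
    (∀ f ∈ multilinear F 5,
      IsIdentity (jordan (FreeAI.op F ℕ)) f ↔ f ∈ consequences (fun n => {g | FullList F n g}) (Fin 5)) ∧
    -- those which come from lower degree are the consequences of the listed ones of lower degree
    oldIdentities F 5 = multilinear F 5 ⊓ consequences (fun n => {g | LowerList F n g}) (Fin 5) ∧
    -- modulo the latter there are exactly two irreducible identities, both of type `(4, 1)`
    ∃ (h₁ : linJJ51 F ∈ allIdentities F 5) (h₂ : linJJ52 F ∈ allIdentities F 5),
      (generatedBy (newRep F 5) (newClass (linJJ51 F) h₁)).toRepresentation.IsIrreducible ∧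
      (generatedBy (newRep F 5) (newClass (linJJ52 F) h₂)).toRepresentation.IsIrreducible ∧
      Nonempty ((generatedBy (newRep F 5) (newClass (linJJ51 F) h₁)).toRepresentation.Equiv
        (spechtHook F 5).toRepresentation) ∧
      Nonempty ((generatedBy (newRep F 5) (newClass (linJJ52 F) h₂)).toRepresentation.Equiv
        (spechtHook F 5).toRepresentation) ∧
      IsCompl (generatedBy (newRep F 5) (newClass (linJJ51 F) h₁)).toSubmodule
        (generatedBy (newRep F 5) (newClass (linJJ52 F) h₂)).toSubmodule := by
  refine ⟨fun f hf => isIdentity_iff_mem_consequences_fullList hf, oldIdentities_five,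
    linJJ5_mem_allIdentities .circ, linJJ5_mem_allIdentities .bullet,
    isIrreducible_newGenerated .circ, isIrreducible_newGenerated .bullet,
    nonempty_newGenerated_equiv_spechtHook .circ, nonempty_newGenerated_equiv_spechtHook .bullet,
    disjoint_newGenerated, codisjoint_newGenerated⟩
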